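/- **Setting.** Let $Z_1,Z_2,\dots$ be i.i.d. random vectors in $\mathbb{R}^{k}$. Let $\Pi_0:\mathbb{R}^k\to\mathbb{R}^{J_1}$ be measurable and $\delta_0\in\mathbb{R}^{k\times J_2}$. Arrange the coordinates of $[\Pi_0(z)^\intercal,(\delta_0^\intercal z)^\intercal]^\intercal$ as $[U(z)^\intercal,V(z)^\intercal]^\intercal$ with $U(z)\in\mathbb{R}^{d_U}$, $V(z)\in\mathbb{R}^{d_V}$, and write $U_i=U(Z_i)$, $V_i=V(Z_i)$; $U_i$ is continuously distributed (as expressed by the densities below) and $V_i$ has finite support. Let $q$ be the number of coordinates of $U$ that are coordinates of $\delta_0^\intercal z$. Let $\hat\Pi=\hat\Pi_n$ (a random function $\mathbb{R}^k\to\mathbb{R}^{J_1}$) and $\hat\delta=\hat\delta_n$ (a random $k\times J_2$ matrix) be preliminary estimators. Let $\mathbf K:\mathbb{R}^{d_U}\times\mathbb{R}^{d_V}\to\mathbb{R}$ be a kernel, and let $h=h_n>0$ be a bandwidth. In $\mathbf K$, the arguments are arranged in the same way as $(U,V)$. Define $$\tilde\Sigma=\frac{\sum_{i_1\neq i_2}\mathbf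 K\big([(\hat\Pi(Z_{i_1})-\hat\Pi(Z_{i_2}))^\intercal,(\hat\delta^\intercal(Z_{i_1}-Z_{i_2}))^\intercal]^\intercal/h\big)(Z_{i_1}-Z_{i_2})(Z_{i_1}-Z_{i_2})^\intercal}{\sum_{i_1\neq i_2}\mathbf K\big([(\hat\Pi(Z_{i_1})-\hat\Pi(Z_{i_2}))^\intercal,(\hat\delta^\intercal(Z_{i_1}-Z_{i_2}))^\intercal]^\intercal/h\big)},\qquad 1\le i_1,i_2\le n .$$ **Assumptions.** 1. (Kernel and bandwidth.) (i) $\mathbf K$ is differentiable with bounded first derivative. (ii) $\mathbf K(u,v)=0$ whenever $\|u\|\ge1$ or $\|v\|\ge1$. (iii) $\int\mathbf K(u,0)\,du=1$ and $\int \mathbf K(u,0)\,u\,du=0$. (iv) $h\to0$ and $nh^{d_U/2}\to\infty$ as $n\to\infty$. 2. (Preliminary estimation.) $\max\{\sup_{z\in\mathrm{supp}(Z)}\|\hat\Pi(z)-\Pi_0(z)\|,\ \|\hat\delta-\delta_0\|\}=o_p(h)$. 3. (Smoothness.) Conditionally on $V_1=V_2$, the vector $U_1-U_2$ has a Lebesgue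 density $f=f_{U_1-U_2\mid V_1=V_2}$. There is a version $m$ of $u\mapsto E[(Z_1-Z_2)(Z_1-Z_2)^\intercal\mid U_1-U_2=u,V_1=V_2]$ such that $m f$ and $f$ are twice continuously differentiable near zero. 4. (Boundedness.) $U_1-U_2$ has a bounded density $f_{U_1-U_2}$ and, given $Z_1$, a conditional density $f_{U_1-U_2\mid Z_1}$ that is bounded (uniformly in the value of $Z_1$). The conditional means $E[\|Z_2\|\mid U_1-U_2,Z_1]$, $E[\|Z_2\|^2\mid U_1-U_2,Z_1]$ and $E[\|Z_1-Z_2\|^4\mid U_1-U_2,V_1=V_2]$ are bounded. 5. (Moments.) If $q\ge3$, then $E\|Z_1\|^{2+q}<\infty$. (For $q\le2$ nothing is assumed here.) **Theorem.** Let $\Sigma_0=E[(Z_1-Z_2)(Z_1-Z_2)^\intercal\mid \Pi_0(Z_1)=\Pi_0(Z_2),\ \delta_0^\intercal Z_1=\delta_0^\intercal Z_2]$, that is, $\Sigma_0=m(0)$. Then $\tilde\Sigma-\Sigma_0=o_p(1)$. -/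

import Mathlib

open MeasureTheory ProbabilityTheory Filter Topology
open scoped NNReal ENNReal Matrix

attribute [local instance] Matrix.frobeniusNormedAddCommGroup

noncomputable section

namespace PairwiseDifference

/-- Euclidean space of dimension `d`. -/
abbrev Vec (d : ℕ) : Type := EuclideanSpace ℝ (Fin d)

/-- `X n = o_p(r n)`, for nonnegative (possibly infinite, possibly non-measurable) `X n`;
for a non-measurable event, `P` is the outer probability. -/
def IsLittleOP {Ω : Type*} [MeasurableSpace Ω] (P : Measure Ω)
    (X : ℕ → Ω → ℝ≥0∞) (r : ℕ → ℝ) : Prop :=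
  ∀ ε : ℝ, 0 < ε →
    Tendsto (fun n => P {ω | ENNReal.ofReal (ε * r n) < X n ω}) atTop (𝓝 0)

/-- The stacked vector `[Π(z)ᵀ, (δᵀ z)ᵀ]ᵀ`. -/
def stackedIndex {k J₁ J₂ : ℕ} (Pi : Vec k → Vec J₁) (δ : Matrix (Fin k) (Fin J₂) ℝ)
    (z : Vec k) : Fin J₁ ⊕ Fin J₂ → ℝ :=
  Sum.elim (fun j => Pi z j) (fun j => (δᵀ *ᵥ (fun i => z i)) j)

/-- The sub-vector `U` of the stacked vector, for the arrangement `e` of its coordinates. -/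
def partU {k J₁ J₂ dU dV : ℕ} (e : Fin J₁ ⊕ Fin J₂ ≃ Fin dU ⊕ Fin dV)
    (Pi : Vec k → Vec J₁) (δ : Matrix (Fin k) (Fin J₂) ℝ) (z : Vec k) : Vec dU :=
  WithLp.toLp 2 fun a => stackedIndex Pi δ z (e.symm (Sum.inl a))

/-- The sub-vector `V` of the stacked vector, for the arrangement `e` of its coordinates. -/
def partV {k J₁ J₂ dU dV : ℕ} (e : Fin J₁ ⊕ Fin J₂ ≃ Fin dU ⊕ Fin dV)
    (Pi : Vec k → Vec J₁) (δ : Matrix (Fin k) (Fin J₂) ℝ) (z : Vec k) : Vec dV :=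
  WithLp.toLp 2 fun b => stackedIndex Pi δ z (e.symm (Sum.inr b))

/-- The number of coordinates of `U` that are coordinates of `δᵀ z`. -/
def linearCount {J₁ J₂ dU dV : ℕ} (e : Fin J₁ ⊕ Fin J₂ ≃ Fin dU ⊕ Fin dV) : ℕ :=
  (Finset.univ.filter fun a : Fin dU => (e.symm (Sum.inl a)).isRight = true).card

/-- The matrix `(x - y)(x - y)ᵀ`. -/
def outerDiff {k : ℕ} (x y : Vec k) : Matrix (Fin k) (Fin k) ℝ :=
  Matrix.vecMulVec (fun i => x i - y i) (fun i => x i - y i)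

/-- Conditions on the kernel `K`, as a function of `(u, v)`. -/
structure IsKernel {dU dV : ℕ} (K : Vec dU × Vec dV → ℝ) : Prop where
  differentiable : Differentiable ℝ K
  bounded_deriv : ∃ C : ℝ, ∀ w, ‖fderiv ℝ K w‖ ≤ C
  support : ∀ u v, 1 ≤ ‖u‖ ∨ 1 ≤ ‖v‖ → K (u, v) = 0
  integral_eq_one : ∫ u : Vec dU, K (u, 0) = 1
  first_moment : ∫ u : Vec dU, K (u, 0) • u = 0

/-- Conditions on the bandwidth when `dim U = dU`. -/
structure IsBandwidth (dU : ℕ) (h : ℕ → ℝ) : Prop where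
  pos : ∀ n, 0 < h n
  tendsto_zero : Tendsto h atTop (𝓝 0)
  tendsto_top : Tendsto (fun n : ℕ => (n : ℝ) * h n ^ ((dU : ℝ) / 2)) atTop atTop

/-- `μ` has a Lebesgue density that is bounded by `C`. -/
def HasDensityLE {d : ℕ} (μ : Measure (Vec d)) (C : ℝ≥0) : Prop :=
  ∃ f : Vec d → ℝ≥0, Measurable f ∧ (∀ u, f u ≤ C) ∧
    μ = (volume : Measure (Vec d)).withDensity fun u => (f u : ℝ≥0∞)

/-- `X` is integrable and `E[X ∣ Y]` is bounded (used for nonnegative `X`). -/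
def HasBoundedCondMean {Ω β : Type*} [MeasurableSpace Ω] [MeasurableSpace β]
    (μ : Measure Ω) (X : Ω → ℝ) (Y : Ω → β) : Prop :=
  Integrable X μ ∧
    ∃ C : ℝ, ∀ᵐ ω ∂μ, |(μ[X | MeasurableSpace.comap Y inferInstance]) ω| ≤ C

/-- The kernel weight of a pair of points `x`, `y`. -/
def pairWeight {k J₁ J₂ dU dV : ℕ} (e : Fin J₁ ⊕ Fin J₂ ≃ Fin dU ⊕ Fin dV)
    (K : Vec dU × Vec dV → ℝ) (h : ℝ) (Pi : Vec k → Vec J₁)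
    (δ : Matrix (Fin k) (Fin J₂) ℝ) (x y : Vec k) : ℝ :=
  K (h⁻¹ • (partU e Pi δ x - partU e Pi δ y), h⁻¹ • (partV e Pi δ x - partV e Pi δ y))

/-- The pairwise-difference kernel estimator from the observations `z 0, …, z (n - 1)`;
the sums run over the pairs of distinct observations. -/
def sigmaTilde {k J₁ J₂ dU dV : ℕ} (e : Fin J₁ ⊕ Fin J₂ ≃ Fin dU ⊕ Fin dV)
    (K : Vec dU × Vec dV → ℝ) (h : ℝ) (Pi : Vec k → Vec J₁)
    (δ : Matrix (Fin k) (Fin J₂) ℝ) (n : ℕ) (z : ℕ → Vec k) : Matrix (Fin k) (Fin k) ℝ :=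
  (∑ p ∈ (Finset.range n).offDiag, pairWeight e K h Pi δ (z p.1) (z p.2))⁻¹ •
    ∑ p ∈ (Finset.range n).offDiag,
      pairWeight e K h Pi δ (z p.1) (z p.2) • outerDiff (z p.1) (z p.2)

/-- `m` is a version of `E[(Z₁ - Z₂)(Z₁ - Z₂)ᵀ ∣ U₁ - U₂ = ·, V₁ = V₂]`: under the conditional
probability `μ` given `V₁ = V₂`, `m (U₁ - U₂)` is, entry by entry, the conditional expectation
given `U₁ - U₂`. -/
def IsPairRegression {Ω : Type*} [MeasurableSpace Ω] {k dU : ℕ} (μ : Measure Ω)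
    (Z₁ Z₂ : Ω → Vec k) (U₁₂ : Ω → Vec dU) (m : Vec dU → Matrix (Fin k) (Fin k) ℝ) : Prop :=
  ∀ a b, Integrable (fun ω => outerDiff (Z₁ ω) (Z₂ ω) a b) μ ∧
    μ[fun ω => outerDiff (Z₁ ω) (Z₂ ω) a b | MeasurableSpace.comap U₁₂ inferInstance]
      =ᵐ[μ] fun ω => m (U₁₂ ω) a b

/-- `f` is a Lebesgue density of `X` under `μ`. -/
def IsDensity {Ω : Type*} [MeasurableSpace Ω] {d : ℕ} (μ : Measure Ω) (X : Ω → Vec d)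
    (f : Vec d → ℝ) : Prop :=
  Measurable f ∧ (∀ u, 0 ≤ f u) ∧
    μ.map X = (volume : Measure (Vec d)).withDensity fun u => ENNReal.ofReal (f u)

end PairwiseDifference

end

/-!
The numerator and the denominator of the estimator are weighted sums over pairs
`∑ K(·) φ(Zᵢ, Zⱼ)`, with `φ` an entry of `(x - y)(x - y)ᵀ`, respectively `φ = 1`. Divided by the
number of pairs and by `h ^ dU`, each of them converges in probability to
`P(V₁ = V₂) * (ψ * f) 0`, where `ψ` is the regression function of `φ` given `U₁ - U₂` and
`V₁ = V₂` (`tendstoInMeasure_weighted_average`). The ratio of the limits is `m 0`, provided that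
`f 0` is positive.

*Positivity of `f 0`* is not assumed; it holds because `f` dominates a multiple of the law of the
difference of two independent copies of `U` restricted to `V = v`, for an atom `v` of `V`. By
Cauchy-Schwarz, two independent copies of a `d`-dimensional vector are within `δ` of each other with
probability of order at least `δ ^ d` (`exists_volume_ball_le_prod`, `cond_density_zero_pos`).

*Means at the true index.* Since `V` has finitely many values, for small `h` the kernel sees only
pairs with `V₁ = V₂` (`eventually_integral_pairWeight_eq`). Conditioning on `U₁ - U₂` and
substituting `u ↦ h • u` gives `∫ K(u, 0) (ψ * f)(h • u) du`, which tends to `(ψ * f) 0`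
(`tendsto_integral_kernel`).

*Fluctuations at the true index.* Pairs without a common index are independent, so the variance
of the normalized sum is of order `1 / (n ^ 2 * h ^ dU) + 1 / n`, which tends to zero
(`variance_sum_offDiag_le`, `tendstoInMeasure_average_offDiag`).

*Preliminary estimation.* If the estimation error is at most `η * h`, a weight changes by at most
a multiple of `min 1 (η * (1 + ‖x - y‖))`, and only if `U x - U y` lies in a box whose sides
are of length `6 * h`, or `6 * h * (1 + ‖x - y‖)` for the `q` coordinates that are linear in `z`
(`IsKernel.exists_pairWeight_sub_le`). This bound does not involve the estimators, so that its mean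
can be computed. The box depends on both points; since `‖x - y‖ ≤ 2 * max ‖x‖ ‖y‖`, the bound is
dominated by the sum of two terms whose box depends on one point only, and the bounded
density of `U x - U₂` gives each box a probability of order `h ^ dU * (1 + ‖x‖) ^ q`
(`lintegral_pairEnvelope_le`). Together with `‖φ‖ ≤ 1 + ‖x - y‖ ^ 2`, the mean is of order `h ^ dU`
times an integral of `min 1 (η * (1 + 2 * ‖x‖)) * (1 + 2 * ‖x‖) ^ (2 + q)`, which is small with `η`
if `Z` has a moment of order `2 + q` (`tendstoInMeasure_estimation_error`). For `q ≤ 2`, this moment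
comes from the fourth moment of `Z₁ - Z₂` given `V₁ = V₂` (`lintegral_norm_pow_four_ne_top`).
-/

noncomputable section

namespace PairwiseDifference

/-! ### Kernel weights and preliminary estimation -/

/-- The box of increments `u` that can carry a nonzero weight at bandwidth `h`: coordinates that
come from `δᵀ z` are bounded by `3 * h * s`, the others by `3 * h`. -/
def slabBox {J₁ J₂ dU dV : ℕ} (e : Fin J₁ ⊕ Fin J₂ ≃ Fin dU ⊕ Fin dV) (h s : ℝ) : Set (Vec dU) :=
  {u | ∀ a, |u a| ≤ 3 * h * if (e.symm (Sum.inl a)).isRight then s else 1}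

lemma IsKernel.exists_lipschitz {dU dV : ℕ} {K : Vec dU × Vec dV → ℝ} (hK : IsKernel K) :
    ∃ L : ℝ, 0 ≤ L ∧ ∀ w w', |K w - K w'| ≤ L * ‖w - w'‖ := by
  obtain ⟨C, hC⟩ := hK.bounded_deriv
  refine ⟨C, (norm_nonneg _).trans (hC 0), fun w w' => ?_⟩
  exact Convex.norm_image_sub_le_of_norm_fderiv_le (fun x _ => hK.differentiable x)
    (fun x _ => hC x) convex_univ (Set.mem_univ w') (Set.mem_univ w)

lemma IsKernel.exists_bound {dU dV : ℕ} {K : Vec dU × Vec dV → ℝ} (hK : IsKernel K) :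
    ∃ B : ℝ, 0 ≤ B ∧ ∀ w, |K w| ≤ B := by
  obtain ⟨B, hB⟩ := (isCompact_closedBall (0 : Vec dU × Vec dV) 1).exists_bound_of_continuousOn
    hK.differentiable.continuous.continuousOn
  have hB0 : 0 ≤ B := (norm_nonneg _).trans (hB 0 (by simp))
  refine ⟨B, hB0, fun w => ?_⟩
  by_cases hw : ‖w‖ ≤ 1
  · exact hB w (by simpa using hw)
  · have : 1 ≤ ‖w.1‖ ∨ 1 ≤ ‖w.2‖ := by
      by_contra! hc
      exact hw (by rw [Prod.norm_def]; exact max_le hc.1.le hc.2.le)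
    have h0 : K w = 0 := hK.support w.1 w.2 this
    simpa [h0] using hB0

lemma abs_apply_le_norm {d : ℕ} (x : Vec d) (a : Fin d) : |x a| ≤ ‖x‖ := by
  simpa using PiLp.norm_apply_le x a

lemma norm_le_sum_abs {d : ℕ} (x : Vec d) : ‖x‖ ≤ ∑ a, |x a| := by
  rw [EuclideanSpace.norm_eq, Real.sqrt_le_left (Finset.sum_nonneg fun _ _ => abs_nonneg _)]
  simpa using Finset.sum_sq_le_sq_sum_of_nonneg (s := Finset.univ) (f := fun a => |x a|)
    (fun _ _ => abs_nonneg _)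

lemma norm_le_mul_of_forall_abs_le {d : ℕ} {x : Vec d} {c : ℝ} (hx : ∀ a, |x a| ≤ c) :
    ‖x‖ ≤ d * c := by
  refine (norm_le_sum_abs x).trans ((Finset.sum_le_sum fun a _ => hx a).trans ?_)
  simp

lemma abs_transpose_mulVec_le {k J : ℕ} (A : Matrix (Fin k) (Fin J) ℝ) (z : Vec k) (j : Fin J) :
    |(Aᵀ *ᵥ (fun i => z i)) j| ≤ ‖A‖ * ‖z‖ := by
  have hA : ‖A‖ ^ 2 = ∑ i, ∑ j, A i j ^ 2 := by
    rw [Matrix.frobenius_norm_def, ← Real.sqrt_eq_rpow, Real.sq_sqrt]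
    · simp
    · exact Finset.sum_nonneg fun i _ => Finset.sum_nonneg fun j _ => by positivity
  have hz : ‖z‖ ^ 2 = ∑ i, z i ^ 2 := by
    rw [EuclideanSpace.norm_eq, Real.sq_sqrt (Finset.sum_nonneg fun i _ => by positivity)]
    simp
  refine abs_le_of_sq_le_sq ?_ (by positivity)
  rw [mul_pow, hA, hz]
  have : (Aᵀ *ᵥ (fun i => z i)) j = ∑ i, A i j * z i := by
    simp [Matrix.mulVec, dotProduct]
  rw [this]
  refine (Finset.sum_mul_sq_le_sq_mul_sq _ _ _).trans ?_
  gcongr with i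
  exact Finset.single_le_sum (f := fun j => A i j ^ 2) (fun j _ => sq_nonneg _) (Finset.mem_univ j)

lemma norm_matrix_le_sum_abs {k : ℕ} (A : Matrix (Fin k) (Fin k) ℝ) :
    ‖A‖ ≤ ∑ p : Fin k × Fin k, |A p.1 p.2| := by
  rw [Matrix.frobenius_norm_def, ← Real.sqrt_eq_rpow,
    Real.sqrt_le_left (Finset.sum_nonneg fun _ _ => abs_nonneg _), ← Fintype.sum_prod_type']
  simpa using Finset.sum_sq_le_sq_sum_of_nonneg (s := Finset.univ)
    (f := fun p : Fin k × Fin k => |A p.1 p.2|) (fun _ _ => abs_nonneg _)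

/-- The effect of the preliminary estimation on the difference of two stacked index vectors. -/
lemma abs_stackedIndex_sub_le {k J₁ J₂ : ℕ} {Pi Pi0 : Vec k → Vec J₁}
    {δ δ0 : Matrix (Fin k) (Fin J₂) ℝ} {x y : Vec k} {t : ℝ}
    (hx : ‖Pi x - Pi0 x‖ ≤ t) (hy : ‖Pi y - Pi0 y‖ ≤ t) (hδ : ‖δ - δ0‖ ≤ t)
    (c : Fin J₁ ⊕ Fin J₂) :
    |(stackedIndex Pi δ x c - stackedIndex Pi δ y c)
      - (stackedIndex Pi0 δ0 x c - stackedIndex Pi0 δ0 y c)|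
      ≤ if c.isRight then t * ‖x - y‖ else 2 * t := by
  cases c with
  | inl j =>
    have h1 := (abs_apply_le_norm _ j).trans hx
    have h2 := (abs_apply_le_norm _ j).trans hy
    simp only [PiLp.sub_apply] at h1 h2
    simp only [stackedIndex, Sum.elim_inl, Sum.isRight_inl, Bool.false_eq_true, if_false]
    rw [abs_le] at *
    constructor <;> linarith [h1.1, h1.2, h2.1, h2.2]
  | inr j =>
    have h1 := abs_transpose_mulVec_le (δ - δ0) (x - y) j
    have h2 : ((δ - δ0)ᵀ *ᵥ (fun i => (x - y) i)) j =
        ((δᵀ *ᵥ fun i => x i) j - (δᵀ *ᵥ fun i => y i) j)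
          - ((δ0ᵀ *ᵥ fun i => x i) j - (δ0ᵀ *ᵥ fun i => y i) j) := by
      simp only [Matrix.mulVec, dotProduct, Matrix.transpose_apply, Matrix.sub_apply,
        PiLp.sub_apply, ← Finset.sum_sub_distrib]
      exact Finset.sum_congr rfl fun i _ => by ring
    simp only [stackedIndex, Sum.elim_inr, Sum.isRight_inr, if_true]
    rw [← h2]
    exact h1.trans (by gcongr)

/-- The preliminary estimation moves the weight of a pair only if the increment `U x - U y` lies
in the box of scale `1 + ‖x - y‖`, and by at most a multiple of `η * (1 + ‖x - y‖)`, where `η * h`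
is the size of the preliminary estimation error. -/
lemma IsKernel.exists_pairWeight_sub_le {k J₁ J₂ dU dV : ℕ}
    (e : Fin J₁ ⊕ Fin J₂ ≃ Fin dU ⊕ Fin dV)
    {K : Vec dU × Vec dV → ℝ} (hK : IsKernel K) (Pi0 : Vec k → Vec J₁)
    (δ0 : Matrix (Fin k) (Fin J₂) ℝ) :
    ∃ C : ℝ, 0 ≤ C ∧ ∀ (h η : ℝ), 0 < h → 0 < η → η ≤ 1 → ∀ (Pi : Vec k → Vec J₁)
      (δ : Matrix (Fin k) (Fin J₂) ℝ) (x y : Vec k),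
      ‖Pi x - Pi0 x‖ ≤ η * h → ‖Pi y - Pi0 y‖ ≤ η * h → ‖δ - δ0‖ ≤ η * h →
      |pairWeight e K h Pi δ x y - pairWeight e K h Pi0 δ0 x y|
        ≤ (slabBox e h (1 + ‖x - y‖)).indicator
            (fun _ => C * min 1 (η * (1 + ‖x - y‖))) (partU e Pi0 δ0 x - partU e Pi0 δ0 y) := by
  obtain ⟨L, hL0, hL⟩ := hK.exists_lipschitz
  obtain ⟨B, hB0, hB⟩ := hK.exists_bound
  -- `2 * B` bounds any change of the weight; `L * (2 * (dU + dV))` is the Lipschitz bound, in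
  -- which the norm of the argument is estimated by the sum of its coordinates
  refine ⟨max (2 * B) (L * (2 * (dU + dV))), by positivity, ?_⟩
  intro h η hh hη hη1 Pi δ x y hx hy hδ
  have hr : 0 ≤ ‖x - y‖ := norm_nonneg _
  have hc := abs_stackedIndex_sub_le hx hy hδ
  have hcoord : ∀ c, |h⁻¹ * (stackedIndex Pi δ x c - stackedIndex Pi δ y c)
      - h⁻¹ * (stackedIndex Pi0 δ0 x c - stackedIndex Pi0 δ0 y c)|
      ≤ 2 * η * (1 + ‖x - y‖) := by
    intro c
    rw [← mul_sub, abs_mul, abs_of_pos (inv_pos.2 hh), inv_mul_le_iff₀ hh]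
    refine (hc c).trans ?_
    split_ifs <;> nlinarith [mul_pos hη hh, mul_nonneg (mul_pos hη hh).le hr]
  by_cases hu : partU e Pi0 δ0 x - partU e Pi0 δ0 y ∈ slabBox e h (1 + ‖x - y‖)
  · rw [Set.indicator_of_mem hu]
    rw [mul_min_of_nonneg _ _ (by positivity)]
    refine le_min ?_ ?_
    · rw [mul_one]
      refine le_trans ?_ (le_max_left _ _)
      refine (abs_sub _ _).trans ?_
      exact (add_le_add (hB _) (hB _)).trans (by linarith)
    · have hs : 0 ≤ 2 * η * (1 + ‖x - y‖) := by positivity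
      calc |pairWeight e K h Pi δ x y - pairWeight e K h Pi0 δ0 x y|
          ≤ L * ((dU + dV) * (2 * η * (1 + ‖x - y‖))) := by
            refine (hL _ _).trans ?_
            gcongr
            rw [Prod.norm_def]
            refine max_le ?_ ?_
            · refine (norm_le_mul_of_forall_abs_le (c := 2 * η * (1 + ‖x - y‖))
                fun a => ?_).trans ?_
              · simpa [partU] using hcoord (e.symm (Sum.inl a))
              · gcongr; simp
            · refine (norm_le_mul_of_forall_abs_le (c := 2 * η * (1 + ‖x - y‖))
                fun a => ?_).trans ?_
              · simpa [partV] using hcoord (e.symm (Sum.inr a))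
              · gcongr; simp
        _ = L * (2 * (dU + dV)) * (η * (1 + ‖x - y‖)) := by ring
        _ ≤ _ := by gcongr; exact le_max_right _ _
  · rw [Set.indicator_of_notMem hu]
    simp only [slabBox, Set.mem_ofPred_eq, not_forall, not_le] at hu
    obtain ⟨a, ha⟩ := hu
    have hca := hc (e.symm (Sum.inl a))
    have hua : (partU e Pi0 δ0 x - partU e Pi0 δ0 y) a =
      stackedIndex Pi0 δ0 x (e.symm (Sum.inl a)) - stackedIndex Pi0 δ0 y (e.symm (Sum.inl a)) := rfl
    have hua' : (partU e Pi δ x - partU e Pi δ y) a =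
      stackedIndex Pi δ x (e.symm (Sum.inl a)) - stackedIndex Pi δ y (e.symm (Sum.inl a)) := rfl
    rw [← hua, ← hua'] at hca
    set p := (partU e Pi0 δ0 x - partU e Pi0 δ0 y) a
    set p' := (partU e Pi δ x - partU e Pi δ y) a
    -- outside the box the coordinate `a` is at least `h` before and after the estimation, so that
    -- both weights vanish
    have key : h ≤ |p| ∧ h ≤ |p'| := by
      have htri : |p| ≤ |p' - p| + |p'| := by
        have := abs_sub_abs_le_abs_sub p p'
        rw [abs_sub_comm] at this; linarith
      have hηh : η * h ≤ h := by nlinarith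
      have hηr : η * h * ‖x - y‖ ≤ h * ‖x - y‖ := by gcongr
      have hhr : 0 ≤ h * ‖x - y‖ := by positivity
      split_ifs at ha hca
      · constructor <;> nlinarith
      · constructor <;> nlinarith
    have hzero : ∀ (u : Vec dU) (v : Vec dV), h ≤ |u a| → K (h⁻¹ • u, v) = 0 := by
      intro u v hua
      refine hK.support _ _ (Or.inl ?_)
      rw [norm_smul, norm_inv, Real.norm_of_nonneg hh.le, ← div_eq_inv_mul, one_le_div hh]
      exact hua.trans (abs_apply_le_norm u a)
    have h1 : pairWeight e K h Pi δ x y = 0 := hzero _ _ key.2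
    have h2 : pairWeight e K h Pi0 δ0 x y = 0 := hzero _ _ key.1
    simp [h1, h2]

lemma IsKernel.exists_pairWeight_le {k J₁ J₂ dU dV : ℕ}
    (e : Fin J₁ ⊕ Fin J₂ ≃ Fin dU ⊕ Fin dV)
    {K : Vec dU × Vec dV → ℝ} (hK : IsKernel K) (Pi0 : Vec k → Vec J₁)
    (δ0 : Matrix (Fin k) (Fin J₂) ℝ) :
    ∃ C : ℝ, 0 ≤ C ∧ ∀ h : ℝ, 0 < h → ∀ x y : Vec k,
      |pairWeight e K h Pi0 δ0 x y|
        ≤ (slabBox e h 1).indicator (fun _ => C) (partU e Pi0 δ0 x - partU e Pi0 δ0 y) := by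
  obtain ⟨B, hB0, hB⟩ := hK.exists_bound
  refine ⟨B, hB0, fun h hh x y => ?_⟩
  by_cases hu : partU e Pi0 δ0 x - partU e Pi0 δ0 y ∈ slabBox e h 1
  · rw [Set.indicator_of_mem hu]; exact hB _
  · rw [Set.indicator_of_notMem hu]
    simp only [slabBox, Set.mem_ofPred_eq, not_forall, not_le, ite_self, mul_one] at hu
    obtain ⟨a, ha⟩ := hu
    have : pairWeight e K h Pi0 δ0 x y = 0 := by
      refine hK.support _ _ (Or.inl ?_)
      rw [norm_smul, norm_inv, Real.norm_of_nonneg hh.le, ← div_eq_inv_mul, one_le_div hh]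
      exact le_trans (by linarith) (ha.le.trans (abs_apply_le_norm _ a))
    simp [this]

/-- The summand `1` makes the bound hold for the constant function `1` as well, which is the
`φ` of the denominator. -/
lemma abs_outerDiff_le {k : ℕ} (x y : Vec k) (a b : Fin k) :
    |outerDiff x y a b| ≤ 1 + ‖x - y‖ ^ 2 := by
  have h1 := abs_apply_le_norm (x - y) a
  have h2 := abs_apply_le_norm (x - y) b
  simp only [PiLp.sub_apply] at h1 h2
  simp only [outerDiff, Matrix.vecMulVec_apply, abs_mul]
  nlinarith [mul_le_mul h1 h2 (abs_nonneg _) (norm_nonneg _)]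

/-! ### Envelopes of the weights of pairs -/

lemma neg_mem_slabBox {J₁ J₂ dU dV : ℕ} {e : Fin J₁ ⊕ Fin J₂ ≃ Fin dU ⊕ Fin dV} {h s : ℝ}
    {u : Vec dU} (hu : u ∈ slabBox e h s) : -u ∈ slabBox e h s := fun a => by
  simpa using hu a

lemma slabBox_mono {J₁ J₂ dU dV : ℕ} (e : Fin J₁ ⊕ Fin J₂ ≃ Fin dU ⊕ Fin dV) {h s t : ℝ}
    (hh : 0 ≤ h) (hst : s ≤ t) : slabBox e h s ⊆ slabBox e h t := fun u hu a => by
  refine (hu a).trans ?_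
  split_ifs <;> gcongr

lemma volume_slabBox {J₁ J₂ dU dV : ℕ} (e : Fin J₁ ⊕ Fin J₂ ≃ Fin dU ⊕ Fin dV) {h s : ℝ}
    (hh : 0 ≤ h) (hs : 0 ≤ s) :
    volume (slabBox e h s) = ENNReal.ofReal ((6 * h) ^ dU * s ^ linearCount e) := by
  set b : Fin dU → ℝ := fun a => 3 * h * if (e.symm (Sum.inl a)).isRight then s else 1
  have hb : ∀ a, 0 ≤ b a := fun a => by
    simp only [b]; split_ifs <;> positivity
  have hmeas : MeasurableSet (slabBox e h s) := by
    have : slabBox e h s = ⋂ a, {u : Vec dU | |u a| ≤ b a} := by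
      ext u; simp [slabBox, b]
    rw [this]
    refine MeasurableSet.iInter fun a => measurableSet_le ?_ measurable_const
    exact (continuous_abs.comp (by fun_prop)).measurable
  rw [← (PiLp.volume_preserving_toLp (Fin dU)).measure_preimage hmeas.nullMeasurableSet]
  have : (WithLp.toLp 2 : (Fin dU → ℝ) → Vec dU) ⁻¹' slabBox e h s =
      Set.univ.pi fun a => Set.Icc (-b a) (b a) := by
    ext u; simp only [slabBox, Set.mem_preimage, Set.mem_ofPred_eq, Set.mem_univ_pi, Set.mem_Icc,
      abs_le, b]
  rw [this, volume_pi_pi]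
  simp only [Real.volume_Icc]
  rw [← ENNReal.ofReal_prod_of_nonneg fun a _ => by linarith [hb a]]
  congr 1
  have hterm : ∀ a, b a - -b a = 6 * h * if (e.symm (Sum.inl a)).isRight then s else 1 := by
    intro a; simp only [b]; ring
  simp only [hterm, Finset.prod_mul_distrib, Finset.prod_const, Finset.card_univ,
    Fintype.card_fin, Finset.prod_ite, one_pow, mul_one, linearCount]
  rw [mul_pow]

lemma measurableSet_mem_slabBox {J₁ J₂ dU dV : ℕ} (e : Fin J₁ ⊕ Fin J₂ ≃ Fin dU ⊕ Fin dV)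
    {α : Type*} [MeasurableSpace α] (h : ℝ) {w : α → Vec dU} (hw : Measurable w) {s : α → ℝ}
    (hs : Measurable s) : MeasurableSet {x | w x ∈ slabBox e h (s x)} := by
  have : {x | w x ∈ slabBox e h (s x)} = ⋂ a, {x | |w x a| ≤
      3 * h * if (e.symm (Sum.inl a)).isRight then s x else 1} := by
    ext u; simp [slabBox]
  rw [this]
  refine MeasurableSet.iInter fun a => measurableSet_le ?_ ?_
  · exact continuous_abs.measurable.comp
      ((EuclideanSpace.proj (𝕜 := ℝ) a).continuous.measurable.comp hw)
  · split_ifs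
    · exact hs.const_mul _
    · exact measurable_const

/-- For almost every `x`, the increment `U x - U y` has, as a function of `y` under `μ`, a
density that is bounded by `C`. -/
def HasBoundedIncrements {k dU : ℕ} (μ : Measure (Vec k)) (U : Vec k → Vec dU) (C : ℝ≥0) : Prop :=
  ∀ᵐ x ∂μ, ∀ B, MeasurableSet B → μ {y | U x - U y ∈ B} ≤ C * volume B

/-- By independence, the conditional law of `U₁ - U₂` given `Z₁ = x` is the law of `U x - U₂`. -/
lemma hasBoundedIncrements_of_condDistrib {Ω : Type*} [MeasurableSpace Ω] {P : Measure Ω}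
    [IsProbabilityMeasure P] {k dU : ℕ} {X Y : Ω → Vec k} (hX : Measurable X) (hY : Measurable Y)
    (hXY : IndepFun X Y P) (hYX : P.map Y = P.map X) {U : Vec k → Vec dU} (hU : Measurable U)
    {C : ℝ≥0} (hC : ∀ᵐ x ∂(P.map X),
      HasDensityLE (condDistrib (fun ω => U (X ω) - U (Y ω)) X P x) C) :
    HasBoundedIncrements (P.map X) U C := by
  have : IsProbabilityMeasure (P.map X) := Measure.isProbabilityMeasure_map hX.aemeasurable
  have hg : Measurable (fun p : Vec k × Vec k => U p.1 - U p.2) := by fun_prop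
  set κ : Kernel (Vec k) (Vec dU) :=
    (Kernel.id ×ₖ Kernel.const (Vec k) (P.map X)).map (fun p => U p.1 - U p.2) with hκ
  have : IsMarkovKernel κ := Kernel.IsMarkovKernel.map _ hg
  have hκx : ∀ x B, MeasurableSet B → κ x B = P.map X {y | U x - U y ∈ B} := by
    intro x B hB
    rw [hκ, Kernel.map_apply' _ hg _ hB, Kernel.prod_apply, Kernel.id_apply, Kernel.const_apply,
      Measure.dirac_prod, Measure.map_apply (by fun_prop) (hg hB)]
    rfl
  have hae : condDistrib (fun ω => U (X ω) - U (Y ω)) X P =ᵐ[P.map X] κ := by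
    refine condDistrib_ae_eq_of_measure_eq_compProd X (by fun_prop) ?_
    ext s hs
    have hm : Measurable (fun p : Vec k × Vec k => (p.1, U p.1 - U p.2)) := by fun_prop
    rw [Measure.compProd_apply hs]
    have h1 : P.map (fun ω => (X ω, U (X ω) - U (Y ω))) =
        (P.map (fun ω => (X ω, Y ω))).map (fun p => (p.1, U p.1 - U p.2)) := by
      rw [Measure.map_map hm (by fun_prop)]; rfl
    rw [h1, hXY.map_prod_eq_prod_map_map hX.aemeasurable hY.aemeasurable, hYX,
      Measure.map_apply hm hs, Measure.prod_apply (hm hs)]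
    refine lintegral_congr fun x => ?_
    rw [hκx x _ (measurable_prodMk_left hs)]
    rfl
  filter_upwards [hae, hC] with x hx ⟨f, hf, hfC, hfx⟩ B hB
  rw [← hκx x B hB, ← hx, hfx, withDensity_apply _ hB]
  calc ∫⁻ u in B, (f u : ℝ≥0∞) ≤ ∫⁻ _ in B, (C : ℝ≥0∞) :=
        lintegral_mono fun u => ENNReal.coe_le_coe.2 (hfC u)
    _ = C * volume B := by simp

open Classical in
/-- Pairs at distance `r` get the weight `Φ r` if their increment lies in the box of scale `s r`. -/
def pairEnvelope {k J₁ J₂ dU dV : ℕ} (e : Fin J₁ ⊕ Fin J₂ ≃ Fin dU ⊕ Fin dV)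
    (U : Vec k → Vec dU) (h : ℝ) (s : ℝ → ℝ) (Φ : ℝ → ℝ≥0∞) (p : Vec k × Vec k) : ℝ≥0∞ :=
  if U p.1 - U p.2 ∈ slabBox e h (s ‖p.1 - p.2‖) then Φ ‖p.1 - p.2‖ else 0

lemma measurable_pairEnvelope {k J₁ J₂ dU dV : ℕ} (e : Fin J₁ ⊕ Fin J₂ ≃ Fin dU ⊕ Fin dV)
    {U : Vec k → Vec dU} (hU : Measurable U) (h : ℝ) {s : ℝ → ℝ} (hs : Measurable s)
    {Φ : ℝ → ℝ≥0∞} (hΦ : Measurable Φ) : Measurable (pairEnvelope e U h s Φ) :=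
  Measurable.ite (measurableSet_mem_slabBox e h (by fun_prop) (by fun_prop)) (by fun_prop)
    measurable_const

lemma pairEnvelope_swap {k J₁ J₂ dU dV : ℕ} (e : Fin J₁ ⊕ Fin J₂ ≃ Fin dU ⊕ Fin dV)
    (U : Vec k → Vec dU) (h : ℝ) (s : ℝ → ℝ) (Φ : ℝ → ℝ≥0∞) (x y : Vec k) :
    pairEnvelope e U h s Φ (y, x) = pairEnvelope e U h s Φ (x, y) := by
  have : U y - U x ∈ slabBox e h (s ‖y - x‖) ↔ U x - U y ∈ slabBox e h (s ‖x - y‖) := by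
    rw [norm_sub_rev y x]
    constructor <;> intro hu <;> simpa using neg_mem_slabBox hu
  unfold pairEnvelope
  by_cases hu : U x - U y ∈ slabBox e h (s ‖x - y‖)
  · rw [if_pos hu, if_pos (this.2 hu), norm_sub_rev]
  · rw [if_neg hu, if_neg (fun h' => hu (this.1 h'))]

open Classical in
/-- The distance of two points is at most twice the larger norm. Since the envelope is monotone
in the distance, it is dominated by the sum of two terms whose weight depends on one of the points
only; in each, the other point is integrated out by means of the bounded density. -/
lemma lintegral_pairEnvelope_le {k J₁ J₂ dU dV : ℕ} (e : Fin J₁ ⊕ Fin J₂ ≃ Fin dU ⊕ Fin dV)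
    {μ : Measure (Vec k)} [IsProbabilityMeasure μ]
    {U : Vec k → Vec dU} (hU : Measurable U) {C : ℝ≥0} (hC : HasBoundedIncrements μ U C)
    {h : ℝ} (hh : 0 ≤ h) {s : ℝ → ℝ} (hs : Monotone s) (hs0 : ∀ r, 0 ≤ r → 0 ≤ s r)
    {Φ : ℝ → ℝ≥0∞} (hΦ : Monotone Φ) :
    ∫⁻ p, pairEnvelope e U h s Φ p ∂(μ.prod μ) ≤
      2 * ∫⁻ x, Φ (2 * ‖x‖) *
        (C * ENNReal.ofReal ((6 * h) ^ dU * s (2 * ‖x‖) ^ linearCount e)) ∂μ := by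
  set F : Vec k × Vec k → ℝ≥0∞ := fun p =>
    if U p.1 - U p.2 ∈ slabBox e h (s (2 * ‖p.1‖)) then Φ (2 * ‖p.1‖) else 0 with hF
  have hFm : Measurable F := by
    have := hΦ.measurable
    have := hs.measurable
    exact Measurable.ite (measurableSet_mem_slabBox e h (by fun_prop) (by fun_prop))
      (by fun_prop) measurable_const
  have hle' : ∀ x y, ‖y‖ ≤ ‖x‖ → pairEnvelope e U h s Φ (x, y) ≤ F (x, y) := by
    intro x y hxy
    have hr : ‖x - y‖ ≤ 2 * ‖x‖ := by linarith [norm_sub_le x y]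
    by_cases hp : U x - U y ∈ slabBox e h (s ‖x - y‖)
    · have hp' := slabBox_mono e hh (hs hr) hp
      simpa only [pairEnvelope, hF, hp, hp', if_true] using hΦ hr
    · simp [pairEnvelope, hp]
  have hle : ∀ p, pairEnvelope e U h s Φ p ≤ F p + F p.swap := by
    rintro ⟨x, y⟩
    rcases le_total ‖y‖ ‖x‖ with hxy | hxy
    · exact (hle' x y hxy).trans le_self_add
    · rw [← pairEnvelope_swap]
      exact (hle' y x hxy).trans le_add_self
  have hFint : ∫⁻ p, F p ∂(μ.prod μ) ≤ ∫⁻ x, Φ (2 * ‖x‖) *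
        (C * ENNReal.ofReal ((6 * h) ^ dU * s (2 * ‖x‖) ^ linearCount e)) ∂μ := by
    rw [lintegral_prod _ hFm.aemeasurable]
    refine lintegral_mono_ae ?_
    filter_upwards [hC] with x hx
    have hB : MeasurableSet (slabBox e h (s (2 * ‖x‖))) :=
      measurableSet_mem_slabBox e h (α := Vec dU) measurable_id
        (measurable_const (a := s (2 * ‖x‖)))
    have hBU : MeasurableSet {y | U x - U y ∈ slabBox e h (s (2 * ‖x‖))} :=
      (show Measurable fun y => U x - U y by fun_prop) hB
    have : (fun y => F (x, y)) =
        {y | U x - U y ∈ slabBox e h (s (2 * ‖x‖))}.indicator fun _ => Φ (2 * ‖x‖) := by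
      ext y; simp [hF, Set.indicator_apply]
    rw [this, lintegral_indicator_const hBU, ← volume_slabBox e hh (hs0 _ (by positivity))]
    gcongr
    exact hx _ hB
  calc ∫⁻ p, pairEnvelope e U h s Φ p ∂(μ.prod μ)
      ≤ ∫⁻ p, (F p + F p.swap) ∂(μ.prod μ) := lintegral_mono hle
    _ = ∫⁻ p, F p ∂(μ.prod μ) + ∫⁻ p, F p ∂(μ.prod μ) := by
        rw [lintegral_add_left hFm, lintegral_prod_swap]
    _ ≤ _ := by rw [← two_mul]; gcongr

/-! ### Sums over pairs of independent observations -/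

lemma map_pair_eq_prod {Ω E : Type*} [MeasurableSpace Ω] [MeasurableSpace E] {P : Measure Ω}
    [IsProbabilityMeasure P] {Z : ℕ → Ω → E} (hZ : ∀ i, Measurable (Z i)) (hind : iIndepFun Z P)
    {μ : Measure E} (hμ : ∀ i, P.map (Z i) = μ) {i j : ℕ} (hij : i ≠ j) :
    P.map (fun ω => (Z i ω, Z j ω)) = μ.prod μ := by
  rw [(hind.indepFun hij).map_prod_eq_prod_map_map (hZ i).aemeasurable (hZ j).aemeasurable,
    hμ i, hμ j]

lemma map_triple_eq_prod {Ω E : Type*} [MeasurableSpace Ω] [MeasurableSpace E] {P : Measure Ω}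
    [IsProbabilityMeasure P] {Z : ℕ → Ω → E} (hZ : ∀ i, Measurable (Z i)) (hind : iIndepFun Z P)
    {μ : Measure E} (hμ : ∀ i, P.map (Z i) = μ) {i j l : ℕ} (hij : i ≠ j) (hil : i ≠ l)
    (hjl : j ≠ l) :
    P.map (fun ω => ((Z i ω, Z j ω), Z l ω)) = (μ.prod μ).prod μ := by
  rw [(hind.indepFun_prodMk hZ i j l hil hjl).map_prod_eq_prod_map_map
    ((hZ i).prodMk (hZ j)).aemeasurable (hZ l).aemeasurable, map_pair_eq_prod hZ hind hμ hij, hμ l]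

lemma lintegral_sum_offDiag {Ω E : Type*} [MeasurableSpace Ω] [MeasurableSpace E] {P : Measure Ω}
    [IsProbabilityMeasure P] {Z : ℕ → Ω → E} (hZ : ∀ i, Measurable (Z i)) (hind : iIndepFun Z P)
    {μ : Measure E} (hμ : ∀ i, P.map (Z i) = μ) {G : E × E → ℝ≥0∞} (hG : Measurable G) (n : ℕ) :
    ∫⁻ ω, ∑ p ∈ (Finset.range n).offDiag, G (Z p.1 ω, Z p.2 ω) ∂P =
      (Finset.range n).offDiag.card * ∫⁻ p, G p ∂(μ.prod μ) := by
  rw [lintegral_finsetSum _ fun p _ => by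
    exact hG.comp ((hZ p.1).prodMk (hZ p.2))]
  rw [Finset.sum_congr rfl (g := fun _ => ∫⁻ p, G p ∂(μ.prod μ))]
  · simp
  · intro p hp
    rw [← map_pair_eq_prod hZ hind hμ (Finset.mem_offDiag.1 hp).2.2,
      lintegral_map hG ((hZ p.1).prodMk (hZ p.2))]

/-- Variance bound for a sum over pairs. Pairs without a common index are independent, so only
pairs that share an index contribute: the `2` arrangements of the same pair, controlled by the
second moment `A` of the kernel, and at most `4 * n` others, controlled by `B`. -/
lemma variance_sum_offDiag_le {Ω E : Type*} [MeasurableSpace Ω] [MeasurableSpace E]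
    {P : Measure Ω} [IsProbabilityMeasure P] {Z : ℕ → Ω → E} (hZ : ∀ i, Measurable (Z i))
    (hind : iIndepFun Z P) {μ : Measure E} (hμ : ∀ i, P.map (Z i) = μ)
    {g : E × E → ℝ} (hg : Measurable g) {Q : E × E → ℝ≥0∞} (hQ : Measurable Q)
    (hQs : ∀ x y, Q (y, x) = Q (x, y)) (hgQ : ∀ p, ‖g p‖ₑ ≤ Q p) {A B : ℝ} (hA0 : 0 ≤ A)
    (hB0 : 0 ≤ B) (hA : ∫⁻ p, Q p ^ 2 ∂(μ.prod μ) ≤ ENNReal.ofReal A)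
    (hB : ∫⁻ p, Q (p.1.1, p.1.2) * Q (p.1.1, p.2) ∂((μ.prod μ).prod μ) ≤ ENNReal.ofReal B)
    (n : ℕ) :
    Var[fun ω => ∑ p ∈ (Finset.range n).offDiag, g (Z p.1 ω, Z p.2 ω); P] ≤
      (Finset.range n).offDiag.card * (2 * A + 4 * n * B) := by
  set X : ℕ × ℕ → Ω → ℝ := fun p ω => g (Z p.1 ω, Z p.2 ω) with hX
  have hZZ : ∀ p : ℕ × ℕ, Measurable fun ω => (Z p.1 ω, Z p.2 ω) := fun p =>
    (hZ p.1).prodMk (hZ p.2)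
  have hXm : ∀ p, Measurable (X p) := fun p => hg.comp (hZZ p)
  have hQ2 : ∀ p ∈ (Finset.range n).offDiag,
      ∫⁻ ω, Q (Z p.1 ω, Z p.2 ω) * Q (Z p.1 ω, Z p.2 ω) ∂P ≤ ENNReal.ofReal A := by
    intro p hp
    refine le_trans (le_of_eq ?_) hA
    rw [← map_pair_eq_prod hZ hind hμ (Finset.mem_offDiag.1 hp).2.2,
      lintegral_map (by fun_prop) (hZZ p)]
    simp only [sq]
  have hQ3 : ∀ i j l : ℕ, i ≠ j → i ≠ l → j ≠ l →
      ∫⁻ ω, Q (Z i ω, Z j ω) * Q (Z i ω, Z l ω) ∂P ≤ ENNReal.ofReal B := by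
    intro i j l hij hil hjl
    refine le_trans (le_of_eq ?_) hB
    rw [← map_triple_eq_prod hZ hind hμ hij hil hjl,
      lintegral_map (by fun_prop) (((hZ i).prodMk (hZ j)).prodMk (hZ l))]
  have hL2 : ∀ p ∈ (Finset.range n).offDiag, MemLp (X p) 2 P := by
    intro p hp
    rw [memLp_two_iff_integrable_sq (hXm p).aestronglyMeasurable]
    refine ⟨((hXm p).pow_const 2).aestronglyMeasurable, lt_of_le_of_lt ?_
      ((hQ2 p hp).trans_lt ENNReal.ofReal_lt_top)⟩
    refine lintegral_mono fun ω => ?_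
    change ‖X p ω ^ 2‖ₑ ≤ _
    rw [sq, enorm_mul]
    gcongr <;> exact hgQ _
  have hmean : ∀ p ∈ (Finset.range n).offDiag, P[X p] = ∫ p, g p ∂(μ.prod μ) := by
    intro p hp
    rw [← map_pair_eq_prod hZ hind hμ (Finset.mem_offDiag.1 hp).2.2,
      integral_map (hZZ p).aemeasurable hg.aestronglyMeasurable]
  have hcov_le : ∀ p ∈ (Finset.range n).offDiag, ∀ q ∈ (Finset.range n).offDiag, ∀ D : ℝ, 0 ≤ D →
      ∫⁻ ω, Q (Z p.1 ω, Z p.2 ω) * Q (Z q.1 ω, Z q.2 ω) ∂P ≤ ENNReal.ofReal D →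
      cov[X p, X q; P] ≤ D := by
    intro p hp q hq D hD hle
    rw [covariance_eq_sub (hL2 p hp) (hL2 q hq), hmean p hp, hmean q hq]
    have h1 : ‖P[X p * X q]‖ₑ ≤ ENNReal.ofReal D := by
      refine (enorm_integral_le_lintegral_enorm _).trans (le_trans ?_ hle)
      refine lintegral_mono fun ω => ?_
      simp only [Pi.mul_apply, enorm_mul]
      gcongr <;> exact hgQ _
    have h2 : |P[X p * X q]| ≤ D := by
      rw [← ofReal_norm, ENNReal.ofReal_le_ofReal_iff hD] at h1
      exact h1
    -- the product of the means is a square, because all pairs have the same law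
    nlinarith [le_abs_self (P[X p * X q]), mul_self_nonneg (∫ p, g p ∂(μ.prod μ))]
  have hcov : ∀ p ∈ (Finset.range n).offDiag, ∀ q ∈ (Finset.range n).offDiag,
      cov[X p, X q; P] ≤ (if q = p then A else 0) + (if q = p.swap then A else 0) +
        ((if q.1 = p.1 then B else 0) + (if q.1 = p.2 then B else 0) +
          (if q.2 = p.1 then B else 0) + (if q.2 = p.2 then B else 0)) := by
    intro p hp q hq
    obtain ⟨i, j⟩ := p
    obtain ⟨l, m⟩ := q
    have hij : i ≠ j := (Finset.mem_offDiag.1 hp).2.2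
    have hlm : l ≠ m := (Finset.mem_offDiag.1 hq).2.2
    have hA' : ∀ c : Prop, [Decidable c] → 0 ≤ if c then A else 0 := fun c _ => by
      split_ifs <;> simp [hA0]
    have hB' : ∀ c : Prop, [Decidable c] → 0 ≤ if c then B else 0 := fun c _ => by
      split_ifs <;> simp [hB0]
    by_cases hs1 : (l, m) = (i, j)
    · rw [if_pos hs1]
      have : cov[X (i, j), X (l, m); P] ≤ A := by
        refine hcov_le _ hp _ hq A hA0 ?_
        rw [hs1]; exact hQ2 _ hp
      linarith [hA' ((l, m) = Prod.swap (i, j)), hB' (l = i), hB' (l = j), hB' (m = i),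
        hB' (m = j)]
    by_cases hs2 : (l, m) = Prod.swap (i, j)
    · rw [if_pos hs2]
      have : cov[X (i, j), X (l, m); P] ≤ A := by
        refine hcov_le _ hp _ hq A hA0 ?_
        rw [hs2]
        refine le_trans (le_of_eq (lintegral_congr fun ω => ?_)) (hQ2 _ hp)
        simp only [Prod.swap_prod_mk]
        rw [hQs (Z i ω)]
      linarith [hA' ((l, m) = (i, j)), hB' (l = i), hB' (l = j), hB' (m = i),
        hB' (m = j)]
    rw [if_neg hs1, if_neg hs2]
    simp only [Prod.swap_prod_mk, Prod.mk.injEq, not_and] at hs1 hs2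
    by_cases h1 : l = i
    · subst h1
      have : cov[X (l, j), X (l, m); P] ≤ B :=
        hcov_le _ hp _ hq B hB0 (hQ3 l j m hij hlm (Ne.symm (hs1 rfl)))
      simp only [if_true]
      linarith [hB' (l = j), hB' (m = l), hB' (m = j)]
    by_cases h2 : l = j
    · subst h2
      have : cov[X (i, l), X (l, m); P] ≤ B := by
        refine hcov_le _ hp _ hq B hB0 (le_trans (le_of_eq (lintegral_congr fun ω => ?_))
          (hQ3 l i m hij.symm hlm (Ne.symm (hs2 rfl))))
        simp only [hQs (Z l ω) (Z i ω)]
      simp only [if_true]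
      linarith [hB' (l = i), hB' (m = i), hB' (m = l)]
    by_cases h3 : m = i
    · subst h3
      have : cov[X (m, j), X (l, m); P] ≤ B := by
        refine hcov_le _ hp _ hq B hB0 (le_trans (le_of_eq (lintegral_congr fun ω => ?_))
          (hQ3 m j l hij hlm.symm (Ne.symm h2)))
        simp only [hQs (Z m ω) (Z l ω)]
      simp only [if_true]
      linarith [hB' (l = m), hB' (l = j), hB' (m = j)]
    by_cases h4 : m = j
    · subst h4
      have : cov[X (i, m), X (l, m); P] ≤ B := by
        refine hcov_le _ hp _ hq B hB0 (le_trans (le_of_eq (lintegral_congr fun ω => ?_))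
          (hQ3 m i l hij.symm hlm.symm (Ne.symm h1)))
        simp only [hQs (Z m ω) (Z l ω), hQs (Z m ω) (Z i ω)]
      simp only [if_true]
      linarith [hB' (l = i), hB' (l = m), hB' (m = i)]
    have : cov[X (i, j), X (l, m); P] = 0 := by
      refine IndepFun.covariance_eq_zero ?_ (hL2 _ hp) (hL2 _ hq)
      exact (hind.indepFun_prodMk_prodMk hZ i j l m (Ne.symm h1) (Ne.symm h3) (Ne.symm h2)
        (Ne.symm h4)).comp hg hg
    rw [this]
    linarith [hB' (l = i), hB' (l = j), hB' (m = i), hB' (m = j)]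
  have hrow : ∀ p ∈ (Finset.range n).offDiag,
      ∑ q ∈ (Finset.range n).offDiag, cov[X p, X q; P] ≤ 2 * A + 4 * n * B := by
    intro p hp
    have hsub : (Finset.range n).offDiag ⊆ Finset.range n ×ˢ Finset.range n := fun q hq => by
      have := Finset.mem_offDiag.1 hq
      exact Finset.mem_product.2 ⟨this.1, this.2.1⟩
    have hp1 := (Finset.mem_offDiag.1 hp).1
    have hp2 := (Finset.mem_offDiag.1 hp).2.1
    refine (Finset.sum_le_sum fun q hq => hcov p hp q hq).trans
      ((Finset.sum_le_sum_of_subset_of_nonneg hsub fun q _ _ => by positivity).trans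
        (le_of_eq ?_))
    have hpm : p ∈ Finset.range n ×ˢ Finset.range n := Finset.mem_product.2 ⟨hp1, hp2⟩
    have hpm' : p.swap ∈ Finset.range n ×ˢ Finset.range n := Finset.mem_product.2 ⟨hp2, hp1⟩
    have hfst : ∀ c ∈ Finset.range n,
        ∑ q ∈ Finset.range n ×ˢ Finset.range n, (if q.1 = c then B else 0) = n * B := by
      intro c hc
      rw [Finset.sum_product_right]
      simp only [Finset.sum_ite_eq', hc, if_true, Finset.sum_const, Finset.card_range,
        nsmul_eq_mul]
    have hsnd : ∀ c ∈ Finset.range n,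
        ∑ q ∈ Finset.range n ×ˢ Finset.range n, (if q.2 = c then B else 0) = n * B := by
      intro c hc
      rw [Finset.sum_product]
      simp only [Finset.sum_ite_eq', hc, if_true, Finset.sum_const, Finset.card_range,
        nsmul_eq_mul]
    simp only [Finset.sum_add_distrib, Finset.sum_ite_eq', hpm, hpm', if_true, hfst _ hp1,
      hfst _ hp2, hsnd _ hp1, hsnd _ hp2]
    ring
  have hsum := variance_sum' (μ := P) (X := X) (s := (Finset.range n).offDiag) hL2
  have hfun : (∑ p ∈ (Finset.range n).offDiag, X p) =
      fun ω => ∑ p ∈ (Finset.range n).offDiag, g (Z p.1 ω, Z p.2 ω) := by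
    ext ω; simp [hX]
  rw [hfun] at hsum
  rw [hsum]
  refine (Finset.sum_le_sum hrow).trans (le_of_eq ?_)
  rw [Finset.sum_const, nsmul_eq_mul]

/-! ### A law of large numbers for pairs at a shrinking scale -/

lemma lintegral_triple_le {E : Type*} [MeasurableSpace E] {μ : Measure E} [IsProbabilityMeasure μ]
    {G I : E × E → ℝ≥0∞} (hG : Measurable G) (hI : Measurable I) {c : ℝ≥0∞}
    (hc : ∀ᵐ x ∂μ, ∫⁻ y, I (x, y) ∂μ ≤ c) :
    ∫⁻ p, G (p.1.1, p.1.2) * I (p.1.1, p.2) ∂((μ.prod μ).prod μ) ≤ c * ∫⁻ p, G p ∂(μ.prod μ) := by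
  rw [lintegral_prod _ (by fun_prop), ← lintegral_const_mul c hG]
  refine lintegral_mono_ae ?_
  filter_upwards [Measure.quasiMeasurePreserving_fst.ae hc] with p hp
  rw [lintegral_const_mul _ (by fun_prop), mul_comm]
  gcongr

lemma lintegral_triple_swap {E : Type*} [MeasurableSpace E] {μ : Measure E}
    [IsProbabilityMeasure μ] {F : E → E → E → ℝ≥0∞}
    (hF : Measurable fun p : (E × E) × E => F p.1.1 p.1.2 p.2) :
    ∫⁻ p, F p.1.1 p.2 p.1.2 ∂((μ.prod μ).prod μ) =
      ∫⁻ p, F p.1.1 p.1.2 p.2 ∂((μ.prod μ).prod μ) := by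
  have hF' : Measurable fun p : (E × E) × E => F p.1.1 p.2 p.1.2 :=
    hF.comp (show Measurable fun p : (E × E) × E => ((p.1.1, p.2), p.1.2) by fun_prop)
  rw [lintegral_prod _ hF'.aemeasurable, lintegral_prod _ hF.aemeasurable,
    lintegral_prod _ hF'.lintegral_prod_right'.aemeasurable,
    lintegral_prod _ hF.lintegral_prod_right'.aemeasurable]
  refine lintegral_congr fun x => ?_
  exact lintegral_lintegral_swap
    (hF'.comp (show Measurable fun p : E × E => ((x, p.1), p.2) by fun_prop)).aemeasurable

open Classical in
/-- Two pairs with one common point: by `a * b ≤ a ^ 2 + b ^ 2`, one of the two weights is squared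
and the other one only contributes the probability of its box, uniformly in the common point. -/
lemma lintegral_pairEnvelope_mul_le {k J₁ J₂ dU dV : ℕ}
    (e : Fin J₁ ⊕ Fin J₂ ≃ Fin dU ⊕ Fin dV) {μ : Measure (Vec k)} [IsProbabilityMeasure μ]
    {U : Vec k → Vec dU} (hU : Measurable U) {C : ℝ≥0} (hC : HasBoundedIncrements μ U C)
    {h : ℝ} (hh : 0 ≤ h) {Φ : ℝ → ℝ≥0∞} (hΦ : Measurable Φ) :
    ∫⁻ p, pairEnvelope e U h (fun _ => 1) Φ (p.1.1, p.1.2) *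
        pairEnvelope e U h (fun _ => 1) Φ (p.1.1, p.2) ∂((μ.prod μ).prod μ) ≤
      2 * (C * ENNReal.ofReal ((6 * h) ^ dU)) *
        ∫⁻ p, pairEnvelope e U h (fun _ => 1) Φ p ^ 2 ∂(μ.prod μ) := by
  set Q := pairEnvelope e U h (fun _ => 1) Φ with hQdef
  set I := pairEnvelope e U h (fun _ => 1) (fun _ => 1) with hIdef
  have hQ : Measurable Q := measurable_pairEnvelope e hU h measurable_const hΦ
  have hI : Measurable I := measurable_pairEnvelope e hU h measurable_const measurable_const
  have hQI : ∀ p, Q p = Q p * I p := by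
    intro p
    simp only [hQdef, hIdef, pairEnvelope]
    split_ifs <;> simp
  have hc : ∀ᵐ x ∂μ, ∫⁻ y, I (x, y) ∂μ ≤ C * ENNReal.ofReal ((6 * h) ^ dU) := by
    filter_upwards [hC] with x hx
    have hB : MeasurableSet (slabBox e h 1) :=
      measurableSet_mem_slabBox e h (α := Vec dU) measurable_id (measurable_const (a := (1 : ℝ)))
    have hBU : MeasurableSet {y | U x - U y ∈ slabBox e h 1} :=
      (show Measurable fun y => U x - U y by fun_prop) hB
    have : (fun y => I (x, y)) = {y | U x - U y ∈ slabBox e h 1}.indicator fun _ => 1 := by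
      ext y; rw [Set.indicator_apply]; simp [hIdef, pairEnvelope]
    rw [this, lintegral_indicator_const hBU, one_mul]
    refine (hx _ hB).trans (le_of_eq ?_)
    rw [volume_slabBox e hh zero_le_one, one_pow, mul_one]
  have hab : ∀ a b : ℝ≥0∞, a * b ≤ a ^ 2 + b ^ 2 := by
    intro a b
    rcases le_total a b with hab | hab
    · exact le_trans (by rw [sq]; gcongr) le_add_self
    · exact le_trans (by rw [sq]; gcongr) le_self_add
  have hpt : ∀ p q : Vec k × Vec k, Q p * Q q ≤ Q p ^ 2 * I q + Q q ^ 2 * I p := by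
    intro p q
    have hI01 : ∀ p, I p = 0 ∨ I p = 1 := by
      intro p
      simp only [hIdef, pairEnvelope]
      split_ifs <;> simp
    rcases hI01 p with hp | hp <;> rcases hI01 q with hq | hq
    · rw [hQI p, hp]; simp
    · rw [hQI p, hp]; simp
    · rw [hQI q, hq]; simp
    · simpa [hp, hq] using hab (Q p) (Q q)
  calc ∫⁻ p, Q (p.1.1, p.1.2) * Q (p.1.1, p.2) ∂((μ.prod μ).prod μ)
      ≤ ∫⁻ p, (Q (p.1.1, p.1.2) ^ 2 * I (p.1.1, p.2) + Q (p.1.1, p.2) ^ 2 * I (p.1.1, p.1.2))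
          ∂((μ.prod μ).prod μ) := lintegral_mono fun p => hpt _ _
    _ = ∫⁻ p, Q (p.1.1, p.1.2) ^ 2 * I (p.1.1, p.2) ∂((μ.prod μ).prod μ) +
          ∫⁻ p, Q (p.1.1, p.1.2) ^ 2 * I (p.1.1, p.2) ∂((μ.prod μ).prod μ) := by
        rw [lintegral_add_left (by fun_prop)]
        congr 1
        exact lintegral_triple_swap (F := fun x y z => Q (x, y) ^ 2 * I (x, z)) (by fun_prop)
    _ ≤ _ := by
        rw [← two_mul, mul_assoc]
        gcongr
        exact lintegral_triple_le (hQ.pow_const 2) hI hc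

/-- A law of large numbers for averages over pairs at a shrinking scale `h n`: by Chebyshev's
inequality, as the variance is of order `1 / (n ^ 2 * h n ^ d) + 1 / n`. -/
lemma tendstoInMeasure_average_offDiag {Ω E : Type*} [MeasurableSpace Ω] [MeasurableSpace E]
    {P : Measure Ω} [IsProbabilityMeasure P] {Z : ℕ → Ω → E} (hZ : ∀ i, Measurable (Z i))
    (hind : iIndepFun Z P) {μ : Measure E} (hμ : ∀ i, P.map (Z i) = μ)
    {d : ℕ} {h : ℕ → ℝ} (hh : IsBandwidth d h)
    {g : ℕ → E × E → ℝ} (hg : ∀ n, Measurable (g n)) {Q : ℕ → E × E → ℝ≥0∞}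
    (hQ : ∀ n, Measurable (Q n))
    (hQs : ∀ n x y, Q n (y, x) = Q n (x, y)) (hgQ : ∀ n p, ‖g n p‖ₑ ≤ Q n p) {A B : ℝ}
    (hA0 : 0 ≤ A) (hB0 : 0 ≤ B)
    (hA : ∀ n, ∫⁻ p, Q n p ^ 2 ∂(μ.prod μ) ≤ ENNReal.ofReal (A * h n ^ d))
    (hB : ∀ n, ∫⁻ p, Q n (p.1.1, p.1.2) * Q n (p.1.1, p.2) ∂((μ.prod μ).prod μ)
      ≤ ENNReal.ofReal (B * (h n ^ d) ^ 2))
    {ℓ : ℝ} (hℓ : Tendsto (fun n => (h n ^ d)⁻¹ * ∫ p, g n p ∂(μ.prod μ)) atTop (𝓝 ℓ)) :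
    TendstoInMeasure P (fun n ω => ((Finset.range n).offDiag.card : ℝ)⁻¹ * (h n ^ d)⁻¹ *
      ∑ p ∈ (Finset.range n).offDiag, g n (Z p.1 ω, Z p.2 ω)) atTop (fun _ => ℓ) := by
  have : IsProbabilityMeasure μ := hμ 0 ▸ Measure.isProbabilityMeasure_map (hZ 0).aemeasurable
  set N : ℕ → ℝ := fun n => ((Finset.range n).offDiag.card : ℝ) with hN
  have hNval : ∀ n, N n = n * n - n := by
    intro n
    simp only [hN, Finset.offDiag_card, Finset.card_range]
    rw [Nat.cast_sub (Nat.le_mul_self n)]; push_cast; ring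
  have hN2 : ∀ n : ℕ, 2 ≤ n → (n : ℝ) ^ 2 ≤ 2 * N n ∧ 0 < N n := by
    intro n hn
    have : (2 : ℝ) ≤ n := by exact_mod_cast hn
    rw [hNval]
    constructor <;> nlinarith
  set S : ℕ → Ω → ℝ := fun n ω => ∑ p ∈ (Finset.range n).offDiag, g n (Z p.1 ω, Z p.2 ω) with hS
  set T : ℕ → Ω → ℝ := fun n ω => (N n)⁻¹ * (h n ^ d)⁻¹ * S n ω with hT
  have hZZ : ∀ p : ℕ × ℕ, Measurable fun ω => (Z p.1 ω, Z p.2 ω) := fun p =>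
    (hZ p.1).prodMk (hZ p.2)
  have hterm : ∀ n, ∀ p ∈ (Finset.range n).offDiag,
      MemLp (fun ω => g n (Z p.1 ω, Z p.2 ω)) 2 P := by
    intro n p hp
    have hm : Measurable fun ω => g n (Z p.1 ω, Z p.2 ω) := (hg n).comp (hZZ p)
    rw [memLp_two_iff_integrable_sq hm.aestronglyMeasurable]
    refine ⟨(hm.pow_const 2).aestronglyMeasurable, lt_of_le_of_lt ?_
      ((hA n).trans_lt ENNReal.ofReal_lt_top)⟩
    rw [← map_pair_eq_prod hZ hind hμ (Finset.mem_offDiag.1 hp).2.2,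
      lintegral_map ((hQ n).pow_const 2) (hZZ p)]
    refine lintegral_mono fun ω => ?_
    rw [enorm_pow]
    gcongr
    exact hgQ _ _
  have hSL2 : ∀ n, MemLp (S n) 2 P := fun n => memLp_finsetSum _ (hterm n)
  have hTL2 : ∀ n, MemLp (T n) 2 P := fun n => (hSL2 n).const_mul _
  have hmean : ∀ n, 2 ≤ n → P[T n] = (h n ^ d)⁻¹ * ∫ p, g n p ∂(μ.prod μ) := by
    intro n hn
    have h1 : P[S n] = N n * ∫ p, g n p ∂(μ.prod μ) := by
      simp only [hS]
      rw [integral_finsetSum _ fun p hp => (hterm n p hp).integrable (by norm_num)]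
      rw [Finset.sum_congr rfl (g := fun _ => ∫ p, g n p ∂(μ.prod μ))]
      · simp [hN]
      · intro p hp
        rw [← map_pair_eq_prod hZ hind hμ (Finset.mem_offDiag.1 hp).2.2,
          integral_map (hZZ p).aemeasurable (hg n).aestronglyMeasurable]
    simp only [hT]
    rw [integral_const_mul, h1]
    have := (hN2 n hn).2.ne'
    field_simp
  have hvar : ∀ n, 2 ≤ n → Var[T n; P] ≤
      4 * A * ((n * h n ^ ((d : ℝ) / 2)) ^ 2)⁻¹ + 8 * B * (n : ℝ)⁻¹ := by
    intro n hn
    have hh0 := hh.pos n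
    have hn0 : (0 : ℝ) < n := by positivity
    obtain ⟨hNa, hN0⟩ := hN2 n hn
    have hhd : (n * h n ^ ((d : ℝ) / 2)) ^ 2 = (n : ℝ) ^ 2 * h n ^ d := by
      rw [mul_pow, ← Real.rpow_natCast (h n ^ ((d : ℝ) / 2)) 2, ← Real.rpow_mul hh0.le,
        ← Real.rpow_natCast (h n) d]
      norm_num
    have hD : 0 < h n ^ d := by positivity
    have h1 := variance_sum_offDiag_le hZ hind hμ (hg n) (hQ n) (hQs n) (hgQ n)
      (by positivity) (by positivity) (hA n) (hB n) n
    rw [hhd]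
    simp only [hT]
    rw [variance_const_mul]
    calc ((N n)⁻¹ * (h n ^ d)⁻¹) ^ 2 * Var[S n; P]
        ≤ ((N n)⁻¹ * (h n ^ d)⁻¹) ^ 2 *
          (N n * (2 * (A * h n ^ d) + 4 * n * (B * (h n ^ d) ^ 2))) := by gcongr
      _ = (N n)⁻¹ * (2 * A * (h n ^ d)⁻¹ + 4 * n * B) := by
          field_simp
      _ ≤ (2 * ((n : ℝ) ^ 2)⁻¹) * (2 * A * (h n ^ d)⁻¹ + 4 * n * B) := by
          gcongr
          rw [inv_le_iff_one_le_mul₀ hN0]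
          field_simp
          exact hNa
      _ = _ := by field_simp; ring
  have hvar0 : Tendsto (fun n : ℕ => 4 * A * ((n * h n ^ ((d : ℝ) / 2)) ^ 2)⁻¹ +
      8 * B * (n : ℝ)⁻¹) atTop (𝓝 0) := by
    have h1 : Tendsto (fun n : ℕ => ((n * h n ^ ((d : ℝ) / 2)) ^ 2)⁻¹) atTop (𝓝 0) :=
      tendsto_inv_atTop_zero.comp ((tendsto_pow_atTop two_ne_zero).comp hh.tendsto_top)
    have h2 : Tendsto (fun n : ℕ => (n : ℝ)⁻¹) atTop (𝓝 0) := tendsto_inv_atTop_nhds_zero_nat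
    simpa using (h1.const_mul (4 * A)).add (h2.const_mul (8 * B))
  rw [tendstoInMeasure_iff_norm]
  intro ε hε
  have hlim : Tendsto (fun n : ℕ => ENNReal.ofReal ((4 * A * ((n * h n ^ ((d : ℝ) / 2)) ^ 2)⁻¹ +
      8 * B * (n : ℝ)⁻¹) / (ε / 2) ^ 2)) atTop (𝓝 0) := by
    simpa using ENNReal.tendsto_ofReal (hvar0.div_const ((ε / 2) ^ 2))
  refine tendsto_of_tendsto_of_tendsto_of_le_of_le' tendsto_const_nhds hlim
    (Eventually.of_forall fun _ => zero_le) ?_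
  have hclose := (Metric.tendsto_nhds.1 hℓ) (ε / 2) (by positivity)
  filter_upwards [hclose, eventually_ge_atTop 2] with n hn hn2
  rw [Real.dist_eq, ← hmean n hn2] at hn
  calc P {ω | ε ≤ ‖T n ω - ℓ‖} ≤ P {ω | ε / 2 ≤ |T n ω - P[T n]|} := by
        refine measure_mono fun ω hω => ?_
        have hω' : ε ≤ |T n ω - ℓ| := hω
        have := abs_sub_le (T n ω) (P[T n]) ℓ
        change ε / 2 ≤ |T n ω - P[T n]|
        linarith
    _ ≤ ENNReal.ofReal (Var[T n; P] / (ε / 2) ^ 2) :=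
        meas_ge_le_variance_div_sq (hTL2 n) (by positivity)
    _ ≤ _ := by
        gcongr
        exact hvar n hn2

/-! ### Positivity of the density at zero -/

lemma sq_lintegral_le_mul {α : Type*} [MeasurableSpace α] (ν : Measure α) {g : α → ℝ≥0∞}
    (hg : Measurable g) : (∫⁻ x, g x ∂ν) ^ 2 ≤ ν Set.univ * ∫⁻ x, g x ^ 2 ∂ν := by
  have h := ENNReal.lintegral_mul_le_Lp_mul_Lq ν Real.HolderConjugate.two_two (f := fun _ => 1)
    (g := g) aemeasurable_const hg.aemeasurable
  simp only [Pi.mul_apply, one_mul, lintegral_const, ENNReal.rpow_two] at h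
  refine (pow_le_pow_left₀ zero_le h 2).trans (le_of_eq ?_)
  rw [mul_pow]
  simp only [← ENNReal.rpow_natCast, ← ENNReal.rpow_mul]
  norm_num

lemma measurable_indicator_ball {d : ℕ} (δ : ℝ) : Measurable (Function.uncurry
    fun x u : Vec d => (Metric.ball u δ).indicator (1 : Vec d → ℝ≥0∞) x) := by
  have hset : MeasurableSet {p : Vec d × Vec d | p.1 ∈ Metric.ball p.2 δ} := by
    simp only [Metric.mem_ball]
    exact measurableSet_lt (by fun_prop) measurable_const
  have : (Function.uncurry fun x u : Vec d => (Metric.ball u δ).indicator (1 : Vec d → ℝ≥0∞) x) =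
      {p : Vec d × Vec d | p.1 ∈ Metric.ball p.2 δ}.indicator 1 := by
    ext ⟨x, u⟩; simp [Function.uncurry, Set.indicator]
  rw [this]
  exact measurable_one.indicator hset

/-- The mass that `ρ` gives to the ball of radius `δ` around `x`, integrated over `x`; by Fubini, each
`u` in the ball of radius `R` contributes the volume of its own `δ`-ball. -/
lemma volume_mul_measure_ball_le {d : ℕ} (ρ : Measure (Vec d)) [IsFiniteMeasure ρ] {δ : ℝ}
    (hδ : δ ≤ 1) (R : ℝ) :
    volume (Metric.ball (0 : Vec d) δ) * ρ (Metric.ball 0 R) ≤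
      ∫⁻ x in Metric.ball (0 : Vec d) (R + 1), ∫⁻ u, (Metric.ball u δ).indicator 1 x ∂ρ := by
  have hkm := measurable_indicator_ball (d := d) δ
  rw [lintegral_lintegral_swap hkm.aemeasurable]
  calc volume (Metric.ball (0 : Vec d) δ) * ρ (Metric.ball 0 R)
      = ∫⁻ u in Metric.ball (0 : Vec d) R, volume (Metric.ball (0 : Vec d) δ) ∂ρ := by simp
    _ ≤ ∫⁻ u in Metric.ball (0 : Vec d) R, (∫⁻ x in Metric.ball (0 : Vec d) (R + 1),
          (Metric.ball u δ).indicator 1 x) ∂ρ := by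
        refine setLIntegral_mono (hkm.lintegral_prod_left
          (μ := volume.restrict (Metric.ball (0 : Vec d) (R + 1)))) fun u hu => ?_
        rw [lintegral_indicator_one Metric.isOpen_ball.measurableSet,
          Measure.restrict_apply Metric.isOpen_ball.measurableSet, Set.inter_eq_left.2,
          Measure.addHaar_ball_center volume u δ]
        intro x hx
        rw [Metric.mem_ball] at hx hu ⊢
        linarith [dist_triangle x u 0]
    _ ≤ _ := setLIntegral_le_lintegral _ _

lemma lintegral_sq_lintegral_eq {α β : Type*} [MeasurableSpace α] [MeasurableSpace β]
    (ν : Measure α) [SFinite ν] (ρ : Measure β) [SFinite ρ] {k : α → β → ℝ≥0∞}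
    (hk : Measurable (Function.uncurry k)) :
    ∫⁻ x, (∫⁻ u, k x u ∂ρ) ^ 2 ∂ν =
      ∫⁻ p, (∫⁻ x, k x p.1 * k x p.2 ∂ν) ∂(ρ.prod ρ) := by
  have h2 : Measurable fun q : α × (β × β) => k q.1 q.2.1 * k q.1 q.2.2 := by
    have ha : Measurable fun q : α × (β × β) => k q.1 q.2.1 :=
      hk.comp (measurable_fst.prodMk measurable_snd.fst)
    have hb : Measurable fun q : α × (β × β) => k q.1 q.2.2 :=
      hk.comp (measurable_fst.prodMk measurable_snd.snd)
    exact ha.mul hb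
  rw [← lintegral_lintegral_swap h2.aemeasurable]
  refine lintegral_congr fun x => ?_
  have hx : Measurable (k x) := hk.of_uncurry_left
  rw [lintegral_prod_mul hx.aemeasurable hx.aemeasurable, sq]

/-- The square of `ρ (ball x δ)` is the mass of the pairs of points which both lie within `δ` of `x`,
and hence within `2 * δ` of each other. -/
lemma lintegral_sq_indicator_ball_le {d : ℕ} (ρ : Measure (Vec d)) [IsFiniteMeasure ρ] (δ : ℝ) :
    ∫⁻ x : Vec d, (∫⁻ u, (Metric.ball u δ).indicator 1 x ∂ρ) ^ 2 ≤
      volume (Metric.ball (0 : Vec d) δ) *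
        (ρ.prod ρ) {p | p.1 - p.2 ∈ Metric.ball (0 : Vec d) (2 * δ)} := by
  set k : Vec d → Vec d → ℝ≥0∞ := fun x u => (Metric.ball u δ).indicator 1 x with hk
  have hkm : Measurable (Function.uncurry k) := measurable_indicator_ball δ
  have h3 : ∀ p : Vec d × Vec d, ∫⁻ x, k x p.1 * k x p.2 ≤
      {p : Vec d × Vec d | p.1 - p.2 ∈ Metric.ball (0 : Vec d) (2 * δ)}.indicator
        (fun _ => volume (Metric.ball (0 : Vec d) δ)) p := by
    intro p
    by_cases hp : p.1 - p.2 ∈ Metric.ball (0 : Vec d) (2 * δ)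
    · rw [Set.indicator_of_mem (by exact hp)]
      calc ∫⁻ x, k x p.1 * k x p.2 ≤ ∫⁻ x, k x p.1 := by
            refine lintegral_mono fun x => ?_
            have : k x p.2 ≤ 1 := Set.indicator_le_self' (by simp) _
            calc k x p.1 * k x p.2 ≤ k x p.1 * 1 := by gcongr
              _ = k x p.1 := mul_one _
        _ = volume (Metric.ball (0 : Vec d) δ) := by
            simp only [hk]
            rw [lintegral_indicator_one Metric.isOpen_ball.measurableSet,
              Measure.addHaar_ball_center]
    · rw [Set.indicator_of_notMem (by exact hp)]
      refine le_of_eq ((lintegral_congr fun x => ?_).trans lintegral_zero)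
      by_contra hne
      apply hp
      have h1 : x ∈ Metric.ball p.1 δ := by
        by_contra h; exact hne (by simp [hk, h])
      have h2 : x ∈ Metric.ball p.2 δ := by
        by_contra h; exact hne (by simp [hk, h])
      rw [Metric.mem_ball] at h1 h2
      rw [mem_ball_zero_iff, ← dist_eq_norm]
      linarith [dist_triangle_left p.1 p.2 x]
  have hset : MeasurableSet {p : Vec d × Vec d | p.1 - p.2 ∈ Metric.ball (0 : Vec d) (2 * δ)} :=
    (measurable_fst.sub measurable_snd) Metric.isOpen_ball.measurableSet
  calc ∫⁻ x, (∫⁻ u, k x u ∂ρ) ^ 2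
      = ∫⁻ p, (∫⁻ x, k x p.1 * k x p.2) ∂(ρ.prod ρ) := lintegral_sq_lintegral_eq _ ρ hkm
    _ ≤ _ := lintegral_mono h3
    _ = _ := lintegral_indicator_const hset _

/-- Two independent copies of a random vector are within `2 * δ` of each other with probability of
order at least `δ ^ d`: by Cauchy-Schwarz on a bounded set, applied to the mass `ρ (ball x δ)` of a
small ball as a function of its center `x`. -/
lemma exists_volume_ball_le_prod {d : ℕ} (ρ : Measure (Vec d)) [IsFiniteMeasure ρ] (hρ : ρ ≠ 0) :
    ∃ c : ℝ≥0∞, c ≠ 0 ∧ ∀ δ : ℝ, 0 < δ → δ ≤ 1 →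
      c * volume (Metric.ball (0 : Vec d) δ) ≤
        (ρ.prod ρ) {p | p.1 - p.2 ∈ Metric.ball (0 : Vec d) (2 * δ)} := by
  obtain ⟨R, hR⟩ : ∃ R : ℕ, ρ (Metric.ball 0 R) ≠ 0 := by
    by_contra! hc
    apply hρ
    rw [← Measure.measure_univ_eq_zero, ← Metric.iUnion_ball_nat (0 : Vec d)]
    exact measure_iUnion_null hc
  have hD0 : volume (Metric.ball (0 : Vec d) (R + 1)) ≠ 0 :=
    (Metric.measure_ball_pos _ _ (by positivity)).ne'
  have hDt : volume (Metric.ball (0 : Vec d) (R + 1)) ≠ ∞ := measure_ball_lt_top.ne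
  refine ⟨ρ (Metric.ball 0 R) ^ 2 * (volume (Metric.ball (0 : Vec d) (R + 1)))⁻¹,
    mul_ne_zero (pow_ne_zero _ hR) (ENNReal.inv_ne_zero.2 hDt), ?_⟩
  intro δ hδ hδ1
  have hb0 : volume (Metric.ball (0 : Vec d) δ) ≠ 0 := (Metric.measure_ball_pos _ _ hδ).ne'
  have hbt : volume (Metric.ball (0 : Vec d) δ) ≠ ∞ := measure_ball_lt_top.ne
  have hlow := volume_mul_measure_ball_le ρ hδ1 R
  have hsq := (setLIntegral_le_lintegral (Metric.ball (0 : Vec d) (R + 1)) _).trans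
    (lintegral_sq_indicator_ball_le ρ δ)
  have hCS := sq_lintegral_le_mul (volume.restrict (Metric.ball (0 : Vec d) (R + 1)))
    ((measurable_indicator_ball (d := d) δ).lintegral_prod_right (ν := ρ))
  rw [Measure.restrict_apply_univ] at hCS
  generalize volume (Metric.ball (0 : Vec d) δ) = b at *
  generalize volume (Metric.ball (0 : Vec d) (R + 1)) = D at *
  generalize (ρ.prod ρ) {p | p.1 - p.2 ∈ Metric.ball (0 : Vec d) (2 * δ)} = X at *
  generalize ρ (Metric.ball 0 R) = a at *
  have hfin : b * (b * a ^ 2) ≤ b * (D * X) := by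
    calc b * (b * a ^ 2) = (b * a) ^ 2 := by ring
      _ ≤ _ := pow_le_pow_left₀ zero_le hlow 2
      _ ≤ D * (b * X) := hCS.trans (mul_le_mul_right hsq D)
      _ = _ := by ring
  have hfin' := (ENNReal.mul_le_mul_iff_right hb0 hbt).1 hfin
  calc a ^ 2 * D⁻¹ * b = D⁻¹ * (b * a ^ 2) := by ring
    _ ≤ D⁻¹ * (D * X) := by gcongr
    _ = X := by rw [← mul_assoc, ENNReal.inv_mul_cancel hD0 hDt, one_mul]

/-- A density that dominates the law of the difference of two independent copies, and that is
continuous at zero, is positive there. -/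
lemma density_zero_pos {d : ℕ} (ρ : Measure (Vec d)) [IsFiniteMeasure ρ] (hρ : ρ ≠ 0)
    {f : Vec d → ℝ} (hf0 : ∀ u, 0 ≤ f u) (hfc : ContinuousAt f 0) {a : ℝ≥0∞} (ha : a ≠ 0)
    (hle : ∀ ε : ℝ, 0 < ε → a * (ρ.prod ρ) {p | p.1 - p.2 ∈ Metric.ball (0 : Vec d) ε} ≤
      ∫⁻ u in Metric.ball (0 : Vec d) ε, ENNReal.ofReal (f u)) : 0 < f 0 := by
  refine lt_of_le_of_ne (hf0 0) fun hzero => ?_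
  obtain ⟨c, hc0, hc⟩ := exists_volume_ball_le_prod ρ hρ
  have hac : 0 < a * c * (2 ^ d)⁻¹ := by
    refine pos_iff_ne_zero.2 (mul_ne_zero (mul_ne_zero ha hc0) (ENNReal.inv_ne_zero.2 ?_))
    exact ENNReal.pow_ne_top (by simp)
  obtain ⟨η, hη0, hη⟩ : ∃ η : ℝ, 0 < η ∧ ENNReal.ofReal η < a * c * (2 ^ d)⁻¹ := by
    obtain ⟨r, hr0, hr⟩ := ENNReal.lt_iff_exists_nnreal_btwn.1 hac
    exact ⟨r, by exact_mod_cast hr0, by simpa using hr⟩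
  have hev : ∀ᶠ u in 𝓝 (0 : Vec d), f u < η :=
    hfc.eventually_lt_const (by rw [← hzero]; exact hη0)
  obtain ⟨r, hr0, hr⟩ := Metric.eventually_nhds_iff_ball.1 hev
  set δ := min 1 (r / 2)
  have hδ0 : 0 < δ := by positivity
  have hδr : 2 * δ ≤ r := by linarith [min_le_right 1 (r / 2)]
  have h1 : a * (c * volume (Metric.ball (0 : Vec d) δ)) ≤
      ENNReal.ofReal η * volume (Metric.ball (0 : Vec d) (2 * δ)) := by
    calc a * (c * volume (Metric.ball (0 : Vec d) δ))
        ≤ a * (ρ.prod ρ) {p | p.1 - p.2 ∈ Metric.ball (0 : Vec d) (2 * δ)} := by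
          gcongr
          exact hc δ hδ0 (min_le_left _ _)
      _ ≤ ∫⁻ u in Metric.ball (0 : Vec d) (2 * δ), ENNReal.ofReal (f u) :=
          hle _ (by positivity)
      _ ≤ ∫⁻ _ in Metric.ball (0 : Vec d) (2 * δ), ENNReal.ofReal η := by
          refine setLIntegral_mono measurable_const fun u hu => ?_
          exact ENNReal.ofReal_le_ofReal (hr u (Metric.ball_subset_ball hδr hu)).le
      _ = _ := by simp
  have hvol : volume (Metric.ball (0 : Vec d) (2 * δ)) =
      2 ^ d * volume (Metric.ball (0 : Vec d) δ) := by
    rw [Measure.addHaar_ball_mul_of_pos volume (0 : Vec d) two_pos]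
    simp [ENNReal.ofReal_pow]
  set b := volume (Metric.ball (0 : Vec d) δ)
  have hb0 : b ≠ 0 := (Metric.measure_ball_pos _ _ hδ0).ne'
  have hbt : b ≠ ∞ := measure_ball_lt_top.ne
  rw [hvol, ← mul_assoc, ← mul_assoc, ENNReal.mul_le_mul_iff_left hb0 hbt] at h1
  have h2 : a * c * (2 ^ d)⁻¹ ≤ ENNReal.ofReal η := by
    rw [← div_eq_mul_inv]
    exact ENNReal.div_le_of_le_mul h1
  exact absurd hη (not_lt.2 h2)

/-! ### Kernel means -/

/-- The kernel mean of `φ`, conditionally on `V₁ = V₂`: the regression function `ψ` of `φ` enters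
through `ψ * f` only, which is continuous near zero. -/
lemma tendsto_integral_kernel {Ω : Type*} [MeasurableSpace Ω] {ν : Measure Ω}
    [IsProbabilityMeasure ν] {dU dV : ℕ} {K : Vec dU × Vec dV → ℝ} (hK : IsKernel K)
    {h : ℕ → ℝ} (hpos : ∀ n, 0 < h n) (hlim : Tendsto h atTop (𝓝 0))
    {X : Ω → Vec dU} (hX : Measurable X) {f : Vec dU → ℝ} (hf : IsDensity ν X f)
    (hfc : ∀ᶠ u in 𝓝 0, ContinuousAt f u) (hf0 : 0 < f 0) {φ : Ω → ℝ} (hφ : Integrable φ ν)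
    {ψ : Vec dU → ℝ} (hψ : ν[φ | MeasurableSpace.comap X inferInstance] =ᵐ[ν] fun ω => ψ (X ω))
    (hψc : ∀ᶠ u in 𝓝 0, ContinuousAt (fun u => ψ u * f u) u) :
    Tendsto (fun n => (h n ^ dU)⁻¹ * ∫ ω, K ((h n)⁻¹ • X ω, 0) * φ ω ∂ν) atTop
      (𝓝 (ψ 0 * f 0)) := by
  classical
  obtain ⟨B, hB0, hB⟩ := hK.exists_bound
  have hKc : Continuous fun u : Vec dU => K (u, 0) :=
    hK.differentiable.continuous.comp (by fun_prop)
  have hKsupp : HasCompactSupport fun u : Vec dU => K (u, 0) := by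
    refine HasCompactSupport.intro (isCompact_closedBall (0 : Vec dU) 1) fun u hu => ?_
    refine hK.support _ _ (Or.inl ?_)
    simp only [Metric.mem_closedBall, dist_zero_right, not_le] at hu
    exact hu.le
  have hKint : Integrable fun u : Vec dU => K (u, 0) :=
    hKc.integrable_of_hasCompactSupport hKsupp
  -- a ball on which `f` is continuous and positive and `ψ * f` is continuous and bounded
  have hbd : ∀ᶠ u in 𝓝 (0 : Vec dU), |ψ u * f u| < |ψ 0 * f 0| + 1 :=
    (hψc.self_of_nhds.abs).eventually_lt_const (by linarith)
  have hfpos : ∀ᶠ u in 𝓝 (0 : Vec dU), 0 < f u :=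
    (hfc.self_of_nhds).eventually_const_lt hf0
  obtain ⟨r, hr0, hr⟩ := Metric.eventually_nhds_iff_ball.1
    (hfc.and (hψc.and (hbd.and hfpos)))
  set D := Metric.ball (0 : Vec dU) r
  have hDm : MeasurableSet D := Metric.isOpen_ball.measurableSet
  have hD0 : (0 : Vec dU) ∈ D := Metric.mem_ball_self hr0
  -- `ψ` need not be measurable; `G` is a measurable function that agrees with it on `D`, which is
  -- all that the kernel sees for large `n`
  set F : Vec dU → ℝ := D.piecewise (fun u => ψ u * f u) 0 with hF
  set G : Vec dU → ℝ := D.piecewise ψ 0 with hG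
  have hFm : Measurable F := by
    refine ContinuousOn.measurable_piecewise ?_ continuousOn_const hDm
    exact fun u hu => (hr u hu).2.1.continuousWithinAt
  have hGm : Measurable G := by
    refine ContinuousOn.measurable_piecewise ?_ continuousOn_const hDm
    have h1 : ContinuousOn (fun u => ψ u * f u / f u) D := fun u hu =>
      ((hr u hu).2.1.div (hr u hu).1 (hr u hu).2.2.2.ne').continuousWithinAt
    refine h1.congr fun u hu => ?_
    have := (hr u hu).2.2.2.ne'
    field_simp
  have hFbd : ∀ u, |F u| ≤ |ψ 0 * f 0| + 1 := by
    intro u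
    by_cases hu : u ∈ D
    · simpa [hF, hu] using (hr u hu).2.2.1.le
    · simp only [hF, hu, not_false_eq_true, Set.piecewise_eq_of_notMem, Pi.zero_apply, abs_zero]
      positivity
  have hFc : ContinuousAt F 0 := by
    refine (hr 0 hD0).2.1.congr ?_
    filter_upwards [Metric.isOpen_ball.mem_nhds hD0] with u hu
    simp [hF, show u ∈ D from hu]
  have hF0 : F 0 = ψ 0 * f 0 := by simp [hF, hD0]
  have hGF : ∀ u, f u * G u = F u := by
    intro u
    by_cases hu : u ∈ D <;> simp [hF, hG, hu, mul_comm]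
  have hval : ∀ᶠ n in atTop, (h n ^ dU)⁻¹ * ∫ ω, K ((h n)⁻¹ • X ω, 0) * φ ω ∂ν =
      ∫ u, K (u, 0) * F (h n • u) := by
    filter_upwards [hlim.eventually_lt_const hr0] with n hn
    have hn0 := hpos n
    set w : Vec dU → ℝ := fun u => K ((h n)⁻¹ • u, 0)
    have hwm : Measurable w := (hKc.comp (by fun_prop)).measurable
    have hw0 : ∀ u, u ∉ D → w u = 0 := by
      intro u hu
      refine hK.support _ _ (Or.inl ?_)
      rw [norm_smul, norm_inv, Real.norm_of_nonneg hn0.le, ← div_eq_inv_mul, one_le_div hn0]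
      simp only [D, mem_ball_zero_iff, not_lt] at hu
      linarith
    have hm : MeasurableSpace.comap X inferInstance ≤ (inferInstance : MeasurableSpace Ω) :=
      hX.comap_le
    have hwX : StronglyMeasurable[MeasurableSpace.comap X inferInstance] fun ω => w (X ω) :=
      hwm.stronglyMeasurable.comp_measurable (comap_measurable X)
    have hint : Integrable ((fun ω => w (X ω)) * φ) ν :=
      hφ.bdd_mul (hwm.comp hX).aestronglyMeasurable (c := B)
        (Eventually.of_forall fun ω => hB _)
    -- `φ` is replaced by its conditional expectation given `X`
    have hstep1 : ∫ ω, w (X ω) * φ ω ∂ν = ∫ ω, w (X ω) * G (X ω) ∂ν := by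
      have h1 := integral_condExp hm (f := (fun ω => w (X ω)) * φ) (μ := ν)
      have h2 := condExp_mul_of_stronglyMeasurable_left hwX hint hφ
      calc ∫ ω, w (X ω) * φ ω ∂ν = ∫ ω, ((fun ω => w (X ω)) * φ) ω ∂ν := rfl
        _ = _ := h1.symm
        _ = ∫ ω, w (X ω) * G (X ω) ∂ν := by
            refine integral_congr_ae ?_
            filter_upwards [h2, hψ] with ω hω1 hω2
            rw [hω1, Pi.mul_apply, hω2]
            by_cases hu : X ω ∈ D
            · simp [hG, hu]
            · simp [hw0 _ hu]
    have hstep2 : ∫ ω, w (X ω) * G (X ω) ∂ν = ∫ u, w u * F u := by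
      rw [← integral_map (f := fun u => w u * G u) hX.aemeasurable
        (hwm.mul hGm).aestronglyMeasurable, hf.2.2,
        integral_withDensity_eq_integral_toReal_smul hf.1.ennreal_ofReal (by simp)]
      refine integral_congr_ae (Eventually.of_forall fun u => ?_)
      simp only [smul_eq_mul]
      rw [ENNReal.toReal_ofReal (hf.2.1 u), ← hGF u]
      ring
    -- the substitution `u ↦ h n • u`
    have hstep3 : ∫ u, w u * F u = h n ^ dU * ∫ u, K (u, 0) * F (h n • u) := by
      have := Measure.integral_comp_inv_smul_of_nonneg (volume : Measure (Vec dU))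
        (fun u => K (u, 0) * F (h n • u)) hn0.le
      simp only [smul_inv_smul₀ hn0.ne', finrank_euclideanSpace, Fintype.card_fin,
        smul_eq_mul] at this
      exact this
    rw [show (∫ ω, K ((h n)⁻¹ • X ω, 0) * φ ω ∂ν) = ∫ ω, w (X ω) * φ ω ∂ν from rfl, hstep1,
      hstep2, hstep3, inv_mul_cancel_left₀ (by positivity)]
  refine Tendsto.congr' (EventuallyEq.symm hval) ?_
  have hlimint : ∫ u, K (u, 0) * F 0 = ψ 0 * f 0 := by
    rw [integral_mul_const, hK.integral_eq_one, one_mul, hF0]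
  rw [← hlimint]
  refine tendsto_integral_filter_of_dominated_convergence
    (fun u => |K (u, 0)| * (|ψ 0 * f 0| + 1)) ?_ ?_ (hKint.abs.mul_const _) ?_
  · refine Eventually.of_forall fun n => (hKc.measurable.mul ?_).aestronglyMeasurable
    exact hFm.comp (measurable_const_smul (h n))
  · refine Eventually.of_forall fun n => Eventually.of_forall fun u => ?_
    rw [Real.norm_eq_abs, abs_mul]
    gcongr
    exact hFbd _
  · refine Eventually.of_forall fun u => ?_
    refine Tendsto.const_mul _ (hFc.tendsto.comp ?_)
    simpa using hlim.smul_const u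

/-! ### Moments and the effect of the preliminary estimation -/

/-- Since `V` has finitely many values, a fourth moment of `Z₁ - Z₂` on `V₁ = V₂` is a fourth moment
of `Z`: each value `v` of positive probability has a point `x` with `V x = v` from which the fourth
power of the distance is integrable on `V = v`. -/
lemma lintegral_norm_pow_four_ne_top {k dV : ℕ} (μ : Measure (Vec k)) [IsProbabilityMeasure μ]
    {V : Vec k → Vec dV} (hV : Measurable V) (S : Finset (Vec dV)) (hS : ∀ᵐ x ∂μ, V x ∈ S)
    (hfin : ∫⁻ p in {p | V p.1 = V p.2}, ‖p.1 - p.2‖ₑ ^ 4 ∂(μ.prod μ) ≠ ∞) :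
    ∫⁻ x, ‖x‖ₑ ^ 4 ∂μ ≠ ∞ := by
  have hset : MeasurableSet {p : Vec k × Vec k | V p.1 = V p.2} :=
    measurableSet_eq_fun (by fun_prop) (by fun_prop)
  have hv : ∀ v, MeasurableSet {y | V y = v} := fun v => hV (measurableSet_singleton v)
  have hmeas : Measurable ({p : Vec k × Vec k | V p.1 = V p.2}.indicator
      fun p => ‖p.1 - p.2‖ₑ ^ 4) := Measurable.indicator (by fun_prop) hset
  rw [← lintegral_indicator hset, lintegral_prod _ hmeas.aemeasurable] at hfin
  have hae := ae_lt_top hmeas.lintegral_prod_right' hfin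
  have hclass : ∀ v, ∫⁻ y in {y | V y = v}, ‖y‖ₑ ^ 4 ∂μ ≠ ∞ := by
    intro v
    by_cases hv0 : μ {y | V y = v} = 0
    · rw [Measure.restrict_eq_zero.2 hv0]; simp
    obtain ⟨x, hxv, hx⟩ := ((frequently_ae_iff.2 hv0).and_eventually hae).exists
    have h1 : ∫⁻ y in {y | V y = v}, ‖x - y‖ₑ ^ 4 ∂μ ≠ ∞ := by
      refine ne_of_lt (lt_of_le_of_lt (le_of_eq ?_) hx)
      rw [← lintegral_indicator (hv v)]
      refine lintegral_congr fun y => ?_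
      by_cases hy : V y = v
      · rw [Set.indicator_of_mem (by exact hy), Set.indicator_of_mem (by exact hxv.trans hy.symm)]
      · rw [Set.indicator_of_notMem (by exact hy), Set.indicator_of_notMem]
        exact fun h => hy (h.symm.trans hxv)
    have hab : ∀ y, ‖y‖ₑ ^ 4 ≤ 2 ^ 4 * (‖x‖ₑ ^ 4 + ‖x - y‖ₑ ^ 4) := by
      intro y
      have htri : ‖y‖ₑ ≤ ‖x‖ₑ + ‖x - y‖ₑ := by
        calc ‖y‖ₑ = ‖x - (x - y)‖ₑ := by rw [sub_sub_cancel]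
          _ ≤ _ := enorm_sub_le
      rcases le_total ‖x‖ₑ ‖x - y‖ₑ with hle | hle
      · calc ‖y‖ₑ ^ 4 ≤ (2 * ‖x - y‖ₑ) ^ 4 := by
              gcongr; exact htri.trans (by rw [two_mul]; gcongr)
          _ = 2 ^ 4 * ‖x - y‖ₑ ^ 4 := mul_pow _ _ _
          _ ≤ _ := by gcongr; exact le_add_self
      · calc ‖y‖ₑ ^ 4 ≤ (2 * ‖x‖ₑ) ^ 4 := by
              gcongr; exact htri.trans (by rw [two_mul]; gcongr)
          _ = 2 ^ 4 * ‖x‖ₑ ^ 4 := mul_pow _ _ _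
          _ ≤ _ := by gcongr; exact le_self_add
    refine ne_top_of_le_ne_top ?_ (lintegral_mono hab)
    rw [lintegral_const_mul _ (by fun_prop), lintegral_add_left measurable_const, lintegral_const]
    refine ENNReal.mul_ne_top (by simp) (ENNReal.add_ne_top.2 ⟨?_, h1⟩)
    exact ENNReal.mul_ne_top (by simp) (measure_ne_top _ _)
  have hle : ∫⁻ x, ‖x‖ₑ ^ 4 ∂μ ≤ ∑ v ∈ S, ∫⁻ y in {y | V y = v}, ‖y‖ₑ ^ 4 ∂μ := by
    simp only [← lintegral_indicator (hv _)]
    rw [← lintegral_finsetSum _ fun v _ => Measurable.indicator (by fun_prop) (hv v)]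
    refine lintegral_mono_ae ?_
    filter_upwards [hS] with x hx
    refine le_trans ?_ (Finset.single_le_sum (f := fun v =>
      {y : Vec k | V y = v}.indicator (fun y => ‖y‖ₑ ^ 4) x) (fun _ _ => zero_le) hx)
    simp
  exact ne_top_of_le_ne_top (ENNReal.sum_ne_top.2 fun v _ => hclass v) hle

lemma lintegral_one_add_pow_ne_top {k : ℕ} {μ : Measure (Vec k)} [IsProbabilityMeasure μ] {p : ℕ}
    (hp : ∫⁻ x, ‖x‖ₑ ^ p ∂μ ≠ ∞) : ∫⁻ x, (1 + 2 * ‖x‖ₑ) ^ p ∂μ ≠ ∞ := by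
  have hle : ∀ x : Vec k, (1 + 2 * ‖x‖ₑ) ^ p ≤ 3 ^ p * (1 + ‖x‖ₑ ^ p) := by
    intro x
    rcases le_total ‖x‖ₑ 1 with h | h
    · calc (1 + 2 * ‖x‖ₑ) ^ p ≤ (1 + 2 * 1) ^ p := by gcongr
        _ = 3 ^ p * 1 := by norm_num
        _ ≤ _ := by gcongr; exact le_self_add
    · calc (1 + 2 * ‖x‖ₑ) ^ p ≤ (‖x‖ₑ + 2 * ‖x‖ₑ) ^ p := by gcongr
        _ = 3 ^ p * ‖x‖ₑ ^ p := by rw [← mul_pow]; ring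
        _ ≤ _ := by gcongr; exact le_add_self
  refine ne_top_of_le_ne_top ?_ (lintegral_mono hle)
  rw [lintegral_const_mul _ (by fun_prop), lintegral_add_left measurable_const]
  exact ENNReal.mul_ne_top (by simp) (ENNReal.add_ne_top.2 ⟨by simp, hp⟩)

lemma lintegral_one_add_pow_two_add_ne_top {k : ℕ} {μ : Measure (Vec k)} [IsProbabilityMeasure μ]
    {q : ℕ} (h4 : ∫⁻ x, ‖x‖ₑ ^ 4 ∂μ ≠ ∞) (hq : 3 ≤ q → ∫⁻ x, ‖x‖ₑ ^ (2 + q) ∂μ ≠ ∞) :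
    ∫⁻ x, (1 + 2 * ‖x‖ₑ) ^ (2 + q) ∂μ ≠ ∞ := by
  rcases Nat.lt_or_ge q 3 with h | h
  · refine ne_top_of_le_ne_top (lintegral_one_add_pow_ne_top h4) (lintegral_mono fun x => ?_)
    exact pow_le_pow_right₀ le_self_add (by omega)
  · exact lintegral_one_add_pow_ne_top (hq h)

lemma ofReal_two_mul_norm {k : ℕ} (x : Vec k) : ENNReal.ofReal (2 * ‖x‖) = 2 * ‖x‖ₑ := by
  rw [ENNReal.ofReal_mul two_pos.le, ofReal_norm]; simp

lemma one_add_sq_le (t : ℝ≥0∞) : 1 + t ^ 2 ≤ (1 + t) ^ 2 := by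
  calc 1 + t ^ 2 ≤ 1 + t ^ 2 + 2 * t := le_self_add
    _ = (1 + t) ^ 2 := by ring

lemma monotone_one_add_sq : Monotone fun r : ℝ => 1 + ENNReal.ofReal r ^ 2 := by
  intro a b hab
  have := ENNReal.ofReal_le_ofReal hab
  simp only
  gcongr

/-- Second moment of the weighted summands at the true index: the fourth moment of `Z` times the
probability of the box. -/
lemma exists_lintegral_pairEnvelope_sq_le {k J₁ J₂ dU dV : ℕ}
    (e : Fin J₁ ⊕ Fin J₂ ≃ Fin dU ⊕ Fin dV) {μ : Measure (Vec k)} [IsProbabilityMeasure μ]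
    {U : Vec k → Vec dU} (hU : Measurable U) {C : ℝ≥0} (hC : HasBoundedIncrements μ U C)
    (h4 : ∫⁻ x, ‖x‖ₑ ^ 4 ∂μ ≠ ∞) (c : ℝ≥0) :
    ∃ A : ℝ, 0 ≤ A ∧ ∀ h : ℝ, 0 ≤ h →
      ∫⁻ p, pairEnvelope e U h (fun _ => 1) (fun r => c * (1 + ENNReal.ofReal r ^ 2)) p ^ 2
        ∂(μ.prod μ) ≤ ENNReal.ofReal (A * h ^ dU) := by
  have hM := lintegral_one_add_pow_ne_top h4
  set M := ∫⁻ x, (1 + 2 * ‖x‖ₑ) ^ 4 ∂μ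
  have hA : 2 * (c : ℝ≥0∞) ^ 2 * C * 6 ^ dU * M ≠ ∞ := by
    refine ENNReal.mul_ne_top (ENNReal.mul_ne_top (ENNReal.mul_ne_top (ENNReal.mul_ne_top ?_ ?_)
      ?_) ?_) hM <;> simp
  refine ⟨(2 * (c : ℝ≥0∞) ^ 2 * C * 6 ^ dU * M).toReal, ENNReal.toReal_nonneg, fun h hh => ?_⟩
  have hsq : ∀ p, pairEnvelope e U h (fun _ => 1) (fun r => c * (1 + ENNReal.ofReal r ^ 2)) p ^ 2 =
      pairEnvelope e U h (fun _ => 1) (fun r => (c * (1 + ENNReal.ofReal r ^ 2)) ^ 2) p := by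
    intro p
    simp only [pairEnvelope]
    split_ifs <;> simp
  have hmono : Monotone fun r : ℝ => ((c : ℝ≥0∞) * (1 + ENNReal.ofReal r ^ 2)) ^ 2 := by
    intro a b hab
    have : 1 + ENNReal.ofReal a ^ 2 ≤ 1 + ENNReal.ofReal b ^ 2 := monotone_one_add_sq hab
    simp only
    gcongr
  simp only [hsq]
  refine (lintegral_pairEnvelope_le e hU hC hh monotone_const (fun _ _ => zero_le_one)
    hmono).trans ?_
  have hpt : ∀ x : Vec k, ((c : ℝ≥0∞) * (1 + ENNReal.ofReal (2 * ‖x‖) ^ 2)) ^ 2 *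
      (C * ENNReal.ofReal ((6 * h) ^ dU * 1 ^ linearCount e)) ≤
      (c : ℝ≥0∞) ^ 2 * (C * ENNReal.ofReal ((6 * h) ^ dU)) * (1 + 2 * ‖x‖ₑ) ^ 4 := by
    intro x
    rw [one_pow, mul_one, ofReal_two_mul_norm, mul_pow]
    calc (c : ℝ≥0∞) ^ 2 * (1 + (2 * ‖x‖ₑ) ^ 2) ^ 2 * (C * ENNReal.ofReal ((6 * h) ^ dU))
        ≤ (c : ℝ≥0∞) ^ 2 * ((1 + 2 * ‖x‖ₑ) ^ 2) ^ 2 * (C * ENNReal.ofReal ((6 * h) ^ dU)) := by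
          gcongr; exact one_add_sq_le _
      _ = _ := by ring
  refine (mul_le_mul_right (lintegral_mono hpt) 2).trans (le_of_eq ?_)
  have h6 : ENNReal.ofReal ((6 * h) ^ dU) = 6 ^ dU * ENNReal.ofReal (h ^ dU) := by
    rw [mul_pow, ENNReal.ofReal_mul (by positivity), ENNReal.ofReal_pow (by norm_num)]
    simp
  rw [lintegral_const_mul _ (by fun_prop), ENNReal.ofReal_mul ENNReal.toReal_nonneg,
    ENNReal.ofReal_toReal hA, h6]
  ring

/-- Mean of the effect of an estimation error of size `η * h`. The factor `(1 + 2 * ‖x‖) ^ 2` comes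
from the size of the summands, and `(1 + 2 * ‖x‖) ^ q` from the volume of the box. -/
lemma lintegral_pairEnvelope_error_le {k J₁ J₂ dU dV : ℕ}
    (e : Fin J₁ ⊕ Fin J₂ ≃ Fin dU ⊕ Fin dV) {μ : Measure (Vec k)} [IsProbabilityMeasure μ]
    {U : Vec k → Vec dU} (hU : Measurable U) {C : ℝ≥0} (hC : HasBoundedIncrements μ U C)
    {h η : ℝ} (hh : 0 ≤ h) (hη : 0 ≤ η) :
    ∫⁻ p, pairEnvelope e U h (fun r => 1 + r)
        (fun r => ENNReal.ofReal (min 1 (η * (1 + r))) * (1 + ENNReal.ofReal r ^ 2)) p ∂(μ.prod μ) ≤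
      ENNReal.ofReal (h ^ dU) * (2 * C * 6 ^ dU * ∫⁻ x, ENNReal.ofReal (min 1 (η * (1 + 2 * ‖x‖))) *
        (1 + 2 * ‖x‖ₑ) ^ (2 + linearCount e) ∂μ) := by
  have hmono : Monotone fun r : ℝ =>
      ENNReal.ofReal (min 1 (η * (1 + r))) * (1 + ENNReal.ofReal r ^ 2) := by
    intro a b hab
    have h1 : 1 + ENNReal.ofReal a ^ 2 ≤ 1 + ENNReal.ofReal b ^ 2 := monotone_one_add_sq hab
    simp only
    gcongr
  refine (lintegral_pairEnvelope_le e hU hC hh (fun a b hab => by simpa using hab)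
    (fun r hr => by positivity) hmono).trans ?_
  rw [← mul_assoc, ← lintegral_const_mul _ (by fun_prop), ← lintegral_const_mul _ (by fun_prop)]
  refine lintegral_mono fun x => ?_
  have h2 : ENNReal.ofReal (1 + 2 * ‖x‖) = 1 + 2 * ‖x‖ₑ := by
    rw [ENNReal.ofReal_add zero_le_one (by positivity), ofReal_two_mul_norm, ENNReal.ofReal_one]
  have h6 : ENNReal.ofReal 6 = 6 := by simp
  rw [ofReal_two_mul_norm, ENNReal.ofReal_mul (by positivity), ENNReal.ofReal_pow (by positivity),
    ENNReal.ofReal_pow (by positivity), h2, ENNReal.ofReal_mul (by norm_num), h6,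
    mul_pow 6 (ENNReal.ofReal h),
    ENNReal.ofReal_pow hh]
  calc _ ≤ 2 * (ENNReal.ofReal (min 1 (η * (1 + 2 * ‖x‖))) * (1 + 2 * ‖x‖ₑ) ^ 2 *
        (C * (6 ^ dU * ENNReal.ofReal h ^ dU * (1 + 2 * ‖x‖ₑ) ^ linearCount e))) := by
        gcongr; exact one_add_sq_le _
    _ = _ := by ring

/-- Dominated convergence; this is where the moment of order `2 + q` enters. -/
lemma tendsto_lintegral_min_mul {k q : ℕ} {μ : Measure (Vec k)}
    (hM : ∫⁻ x, (1 + 2 * ‖x‖ₑ) ^ (2 + q) ∂μ ≠ ∞) :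
    Tendsto (fun j : ℕ => ∫⁻ x, ENNReal.ofReal (min 1 (1 / ((j : ℝ) + 1) * (1 + 2 * ‖x‖))) *
      (1 + 2 * ‖x‖ₑ) ^ (2 + q) ∂μ) atTop (𝓝 0) := by
  rw [← lintegral_zero (μ := μ)]
  refine tendsto_lintegral_filter_of_dominated_convergence
    (fun x => (1 + 2 * ‖x‖ₑ) ^ (2 + q)) (Eventually.of_forall fun j => by fun_prop)
    (Eventually.of_forall fun j => Eventually.of_forall fun x => ?_) hM
    (Eventually.of_forall fun x => ?_)
  · have : ENNReal.ofReal (min 1 (1 / ((j : ℝ) + 1) * (1 + 2 * ‖x‖))) ≤ 1 := by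
      rw [← ENNReal.ofReal_one]
      exact ENNReal.ofReal_le_ofReal (min_le_left _ _)
    calc _ ≤ 1 * (1 + 2 * ‖x‖ₑ) ^ (2 + q) := by gcongr
      _ = _ := one_mul _
  · have h1 : Tendsto (fun j : ℕ => min 1 (1 / ((j : ℝ) + 1) * (1 + 2 * ‖x‖))) atTop (𝓝 0) := by
      have := (tendsto_one_div_add_atTop_nhds_zero_nat (𝕜 := ℝ)).mul_const (1 + 2 * ‖x‖)
      simpa using (tendsto_const_nhds (x := (1 : ℝ))).min this
    have h2 := ENNReal.tendsto_ofReal h1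
    rw [ENNReal.ofReal_zero] at h2
    have hne : (1 + 2 * ‖x‖ₑ) ^ (2 + q) ≠ ∞ := by
      refine ENNReal.pow_ne_top (ENNReal.add_ne_top.2 ⟨by simp, ?_⟩)
      exact ENNReal.mul_ne_top (by simp) enorm_ne_top
    simpa using ENNReal.Tendsto.mul_const h2 (Or.inr hne)

/-- The preliminary estimation does not affect the normalized weighted sums: outside an event of
vanishing probability, its effect is bounded by a sum over pairs of envelopes that do not involve
the estimators, and the mean of that sum is arbitrarily small. -/
lemma tendstoInMeasure_estimation_error {Ω : Type*} [MeasurableSpace Ω] {P : Measure Ω}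
    [IsProbabilityMeasure P] {k J₁ J₂ dU dV : ℕ} {Z : ℕ → Ω → Vec k}
    (hZ : ∀ i, Measurable (Z i)) (hind : iIndepFun Z P)
    (hμ : ∀ i, P.map (Z i) = P.map (Z 0))
    {Pi0 : Vec k → Vec J₁} {δ0 : Matrix (Fin k) (Fin J₂) ℝ}
    (e : Fin J₁ ⊕ Fin J₂ ≃ Fin dU ⊕ Fin dV) (hU : Measurable (partU e Pi0 δ0))
    {K : Vec dU × Vec dV → ℝ} (hK : IsKernel K) {h : ℕ → ℝ} (hpos : ∀ n, 0 < h n)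
    {PiHat : ℕ → Ω → Vec k → Vec J₁} {δHat : ℕ → Ω → Matrix (Fin k) (Fin J₂) ℝ}
    (h_prelim : IsLittleOP P
      (fun n ω => max (⨆ z ∈ (P.map (Z 0)).support, ‖PiHat n ω z - Pi0 z‖ₑ)
        ‖δHat n ω - δ0‖ₑ) h)
    {C : ℝ≥0} (hC : HasBoundedIncrements (P.map (Z 0)) (partU e Pi0 δ0) C)
    (hM : ∫⁻ x, (1 + 2 * ‖x‖ₑ) ^ (2 + linearCount e) ∂(P.map (Z 0)) ≠ ∞)
    {φ : Vec k → Vec k → ℝ} (hφ : ∀ x y, |φ x y| ≤ 1 + ‖x - y‖ ^ 2) :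
    TendstoInMeasure P (fun n ω => ((Finset.range n).offDiag.card : ℝ)⁻¹ * (h n ^ dU)⁻¹ *
      ∑ p ∈ (Finset.range n).offDiag,
        (pairWeight e K (h n) (PiHat n ω) (δHat n ω) (Z p.1 ω) (Z p.2 ω)
          - pairWeight e K (h n) Pi0 δ0 (Z p.1 ω) (Z p.2 ω)) * φ (Z p.1 ω) (Z p.2 ω))
      atTop (fun _ => 0) := by
  have hprob : IsProbabilityMeasure (P.map (Z 0)) :=
    Measure.isProbabilityMeasure_map (hZ 0).aemeasurable
  obtain ⟨D, hD0, hD⟩ := hK.exists_pairWeight_sub_le e Pi0 δ0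
  rw [tendstoInMeasure_iff_norm]
  intro ε hε
  rw [ENNReal.tendsto_nhds_zero]
  intro κ hκ
  have hκ2 : 0 < κ / 2 := ENNReal.half_pos hκ.ne'
  set c0 : ℝ≥0∞ := (ENNReal.ofReal ε)⁻¹ * ENNReal.ofReal D * (2 * C * 6 ^ dU)
  have hε0 : ENNReal.ofReal ε ≠ 0 := by simpa using hε
  have hc0 : c0 ≠ ∞ := by
    refine ENNReal.mul_ne_top (ENNReal.mul_ne_top (ENNReal.inv_ne_top.2 hε0) ENNReal.ofReal_ne_top)
      (ENNReal.mul_ne_top (ENNReal.mul_ne_top (by simp) (by simp)) (by simp))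
  obtain ⟨j, hj⟩ : ∃ j : ℕ, c0 * ∫⁻ x, ENNReal.ofReal (min 1 (1 / ((j : ℝ) + 1) *
      (1 + 2 * ‖x‖))) * (1 + 2 * ‖x‖ₑ) ^ (2 + linearCount e) ∂(P.map (Z 0)) ≤ κ / 2 := by
    have := ENNReal.Tendsto.const_mul (tendsto_lintegral_min_mul hM) (Or.inr hc0)
    rw [mul_zero] at this
    exact ((ENNReal.tendsto_nhds_zero.1 this) _ hκ2).exists
  set η : ℝ := 1 / ((j : ℝ) + 1)
  have hη0 : 0 < η := by positivity
  have hη1 : η ≤ 1 := by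
    rw [div_le_one (by positivity)]
    linarith [Nat.cast_nonneg (α := ℝ) j]
  have hsupp : ∀ᵐ ω ∂P, ∀ i, Z i ω ∈ (P.map (Z 0)).support := by
    rw [ae_all_iff]
    intro i
    refine ae_of_ae_map (hZ i).aemeasurable ?_
    rw [hμ i]
    exact Measure.support_mem_ae
  filter_upwards [(ENNReal.tendsto_nhds_zero.1 (h_prelim η hη0)) _ hκ2] with n hn
  have hh0 := hpos n
  set E := pairEnvelope e (partU e Pi0 δ0) (h n) (fun r => 1 + r)
    (fun r => ENNReal.ofReal (min 1 (η * (1 + r))) * (1 + ENNReal.ofReal r ^ 2)) with hE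
  have hEm : Measurable E := measurable_pairEnvelope e hU _ (by fun_prop) (by fun_prop)
  set N : ℝ≥0∞ := ((Finset.range n).offDiag.card : ℝ≥0∞) with hN
  set R : Ω → ℝ≥0∞ := fun ω => N⁻¹ * (ENNReal.ofReal (h n ^ dU))⁻¹ * ENNReal.ofReal D *
    ∑ p ∈ (Finset.range n).offDiag, E (Z p.1 ω, Z p.2 ω) with hR
  have hsumm : Measurable fun ω => ∑ p ∈ (Finset.range n).offDiag, E (Z p.1 ω, Z p.2 ω) :=
    Finset.measurable_fun_sum _ fun p _ => hEm.comp ((hZ p.1).prodMk (hZ p.2))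
  have hRint : ∫⁻ ω, R ω ∂P ≤ ENNReal.ofReal D * (2 * C * 6 ^ dU *
      ∫⁻ x, ENNReal.ofReal (min 1 (η * (1 + 2 * ‖x‖))) *
        (1 + 2 * ‖x‖ₑ) ^ (2 + linearCount e) ∂(P.map (Z 0))) := by
    have hb := lintegral_pairEnvelope_error_le e hU hC hh0.le hη0.le
    rw [← hE] at hb
    generalize ∫⁻ x, ENNReal.ofReal (min 1 (η * (1 + 2 * ‖x‖))) *
        (1 + 2 * ‖x‖ₑ) ^ (2 + linearCount e) ∂(P.map (Z 0)) = I at hb ⊢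
    simp only [hR]
    rw [lintegral_const_mul _ hsumm, lintegral_sum_offDiag hZ hind hμ hEm n, ← hN]
    have hhd : ENNReal.ofReal (h n ^ dU) ≠ 0 := by
      simp only [ne_eq, ENNReal.ofReal_eq_zero, not_le]; positivity
    calc N⁻¹ * (ENNReal.ofReal (h n ^ dU))⁻¹ * ENNReal.ofReal D *
          (N * ∫⁻ p, E p ∂((P.map (Z 0)).prod (P.map (Z 0))))
        ≤ N⁻¹ * (ENNReal.ofReal (h n ^ dU))⁻¹ * ENNReal.ofReal D *
          (N * (ENNReal.ofReal (h n ^ dU) * (2 * C * 6 ^ dU * I))) := by gcongr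
      _ = (N⁻¹ * N) * ((ENNReal.ofReal (h n ^ dU))⁻¹ * ENNReal.ofReal (h n ^ dU)) *
          (ENNReal.ofReal D * (2 * C * 6 ^ dU * I)) := by ring
      _ ≤ 1 * 1 * (ENNReal.ofReal D * (2 * C * 6 ^ dU * I)) := by
          gcongr
          · exact ENNReal.inv_mul_le_one _
          · exact ENNReal.inv_mul_le_one _
      _ = _ := by ring
  have hmarkov : P {ω | ENNReal.ofReal ε ≤ R ω} ≤ κ / 2 := by
    have hRm : Measurable R := hsumm.const_mul _
    refine (meas_ge_le_lintegral_div hRm.aemeasurable hε0 ENNReal.ofReal_ne_top).trans ?_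
    refine le_trans ?_ hj
    refine (ENNReal.div_le_div_right hRint _).trans (le_of_eq ?_)
    rw [div_eq_mul_inv]
    ring
  -- the exceptional events: an observation outside the support, an estimation error larger than
  -- `η * h n`, a large sum of envelopes; inclusion and subadditivity need no measurability
  have hsub : {ω | ε ≤ ‖((Finset.range n).offDiag.card : ℝ)⁻¹ * (h n ^ dU)⁻¹ *
      (∑ p ∈ (Finset.range n).offDiag,
        (pairWeight e K (h n) (PiHat n ω) (δHat n ω) (Z p.1 ω) (Z p.2 ω)
          - pairWeight e K (h n) Pi0 δ0 (Z p.1 ω) (Z p.2 ω)) * φ (Z p.1 ω) (Z p.2 ω)) - 0‖} ⊆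
      {ω | ¬ ∀ i, Z i ω ∈ (P.map (Z 0)).support} ∪
      ({ω | ENNReal.ofReal (η * h n) < max (⨆ z ∈ (P.map (Z 0)).support, ‖PiHat n ω z - Pi0 z‖ₑ)
        ‖δHat n ω - δ0‖ₑ} ∪ {ω | ENNReal.ofReal ε ≤ R ω}) := by
    intro ω hω
    by_contra hcon
    simp only [Set.mem_union, Set.mem_ofPred_eq, not_or, not_not, not_lt, not_le] at hcon hω
    obtain ⟨hs, hgood, hlt⟩ := hcon
    rw [sub_zero] at hω
    refine absurd hlt (not_lt.2 ?_)
    have hηh : 0 ≤ η * h n := by positivity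
    have hPi : ∀ i, ‖PiHat n ω (Z i ω) - Pi0 (Z i ω)‖ ≤ η * h n := by
      intro i
      have h1 : ‖PiHat n ω (Z i ω) - Pi0 (Z i ω)‖ₑ ≤ ENNReal.ofReal (η * h n) :=
        (le_iSup₂ (f := fun z (_ : z ∈ (P.map (Z 0)).support) => ‖PiHat n ω z - Pi0 z‖ₑ)
          (Z i ω) (hs i)).trans ((le_max_left _ _).trans hgood)
      rwa [← ofReal_norm, ENNReal.ofReal_le_ofReal_iff hηh] at h1
    have hδ : ‖δHat n ω - δ0‖ ≤ η * h n := by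
      have h1 := (le_max_right _ _).trans hgood
      rwa [← ofReal_norm, ENNReal.ofReal_le_ofReal_iff hηh] at h1
    have hterm : ∀ p : ℕ × ℕ,
        ‖(pairWeight e K (h n) (PiHat n ω) (δHat n ω) (Z p.1 ω) (Z p.2 ω)
          - pairWeight e K (h n) Pi0 δ0 (Z p.1 ω) (Z p.2 ω)) * φ (Z p.1 ω) (Z p.2 ω)‖ₑ ≤
        ENNReal.ofReal D * E (Z p.1 ω, Z p.2 ω) := by
      intro p
      have h1 := hD (h n) η hh0 hη0 hη1 (PiHat n ω) (δHat n ω) (Z p.1 ω) (Z p.2 ω) (hPi p.1)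
        (hPi p.2) hδ
      have h2 := hφ (Z p.1 ω) (Z p.2 ω)
      rw [enorm_mul, ← ofReal_norm, ← ofReal_norm, Real.norm_eq_abs, Real.norm_eq_abs]
      simp only [hE, pairEnvelope]
      split_ifs with hmem
      · rw [Set.indicator_of_mem hmem] at h1
        rw [← mul_assoc, ← ENNReal.ofReal_mul hD0]
        gcongr
        refine (ENNReal.ofReal_le_ofReal h2).trans (le_of_eq ?_)
        rw [ENNReal.ofReal_add zero_le_one (by positivity), ENNReal.ofReal_one,
          ENNReal.ofReal_pow (norm_nonneg _)]
      · rw [Set.indicator_of_notMem hmem] at h1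
        rw [ENNReal.ofReal_eq_zero.2 h1]
        simp
    calc ENNReal.ofReal ε ≤ ENNReal.ofReal ‖((Finset.range n).offDiag.card : ℝ)⁻¹ *
          (h n ^ dU)⁻¹ * (∑ p ∈ (Finset.range n).offDiag,
        (pairWeight e K (h n) (PiHat n ω) (δHat n ω) (Z p.1 ω) (Z p.2 ω)
          - pairWeight e K (h n) Pi0 δ0 (Z p.1 ω) (Z p.2 ω)) * φ (Z p.1 ω) (Z p.2 ω))‖ :=
          ENNReal.ofReal_le_ofReal hω
      _ ≤ R ω := by
          simp only [hR]
          rw [ofReal_norm, enorm_mul, enorm_mul, mul_assoc _ (ENNReal.ofReal D), Finset.mul_sum]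
          gcongr
          · rw [← ofReal_norm, norm_inv, Real.norm_natCast]
            rcases Nat.eq_zero_or_pos (Finset.range n).offDiag.card with hz | hp
            · simp [hz]
            · rw [ENNReal.ofReal_inv_of_pos (by exact_mod_cast hp), ENNReal.ofReal_natCast]
          · rw [← ofReal_norm, norm_inv, Real.norm_of_nonneg (by positivity),
              ENNReal.ofReal_inv_of_pos (by positivity)]
          · refine (enorm_sum_le _ _).trans (Finset.sum_le_sum fun p _ => hterm p)
  calc _ ≤ _ := measure_mono hsub
    _ ≤ 0 + (κ / 2 + κ / 2) := by
        refine (measure_union_le _ _).trans (add_le_add (le_of_eq ?_)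
          ((measure_union_le _ _).trans (add_le_add hn hmarkov)))
        exact hsupp
    _ = κ := by rw [zero_add, ENNReal.add_halves]

/-! ### Limits of the weighted averages -/

lemma measurable_stackedIndex {k J₁ J₂ : ℕ} {Pi : Vec k → Vec J₁} (hPi : Measurable Pi)
    (δ : Matrix (Fin k) (Fin J₂) ℝ) (c : Fin J₁ ⊕ Fin J₂) :
    Measurable fun z => stackedIndex Pi δ z c := by
  cases c with
  | inl j =>
    exact (EuclideanSpace.proj (𝕜 := ℝ) j).continuous.measurable.comp hPi
  | inr j =>
    simp only [stackedIndex, Sum.elim_inr, Matrix.mulVec, dotProduct]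
    refine Finset.measurable_fun_sum _ fun i _ => Measurable.const_mul ?_ _
    exact (EuclideanSpace.proj (𝕜 := ℝ) i).continuous.measurable

lemma measurable_partU {k J₁ J₂ dU dV : ℕ} (e : Fin J₁ ⊕ Fin J₂ ≃ Fin dU ⊕ Fin dV)
    {Pi : Vec k → Vec J₁} (hPi : Measurable Pi) (δ : Matrix (Fin k) (Fin J₂) ℝ) :
    Measurable (partU e Pi δ) :=
  (WithLp.measurable_toLp 2 _).comp
    (measurable_pi_lambda _ fun _ => measurable_stackedIndex hPi δ _)

lemma measurable_partV {k J₁ J₂ dU dV : ℕ} (e : Fin J₁ ⊕ Fin J₂ ≃ Fin dU ⊕ Fin dV)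
    {Pi : Vec k → Vec J₁} (hPi : Measurable Pi) (δ : Matrix (Fin k) (Fin J₂) ℝ) :
    Measurable (partV e Pi δ) :=
  (WithLp.measurable_toLp 2 _).comp
    (measurable_pi_lambda _ fun _ => measurable_stackedIndex hPi δ _)

lemma measurable_pairWeight {k J₁ J₂ dU dV : ℕ} (e : Fin J₁ ⊕ Fin J₂ ≃ Fin dU ⊕ Fin dV)
    {K : Vec dU × Vec dV → ℝ} (hK : IsKernel K) (h : ℝ) {Pi : Vec k → Vec J₁}
    (hPi : Measurable Pi) (δ : Matrix (Fin k) (Fin J₂) ℝ) :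
    Measurable fun p : Vec k × Vec k => pairWeight e K h Pi δ p.1 p.2 := by
  have hU := measurable_partU e hPi δ
  have hV := measurable_partV e hPi δ
  exact hK.differentiable.continuous.measurable.comp (by fun_prop)

lemma tendstoInMeasure_add_zero {Ω : Type*} [MeasurableSpace Ω] {P : Measure Ω}
    {X Y : ℕ → Ω → ℝ} {ℓ : ℝ} (hX : TendstoInMeasure P X atTop (fun _ => 0))
    (hY : TendstoInMeasure P Y atTop (fun _ => ℓ)) :
    TendstoInMeasure P (fun n ω => X n ω + Y n ω) atTop (fun _ => ℓ) := by
  rw [tendstoInMeasure_iff_norm] at *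
  intro ε hε
  have h1 := (hX (ε / 2) (by positivity)).add (hY (ε / 2) (by positivity))
  rw [add_zero] at h1
  refine tendsto_of_tendsto_of_tendsto_of_le_of_le tendsto_const_nhds h1
    (fun _ => zero_le) fun n => ?_
  refine (measure_mono fun ω hω => ?_).trans (measure_union_le _ _)
  by_contra hcon
  simp only [Set.mem_union, Set.mem_ofPred_eq, not_or, not_le, sub_zero] at hcon hω
  have := norm_add_le (X n ω) (Y n ω - ℓ)
  rw [← add_sub_assoc] at this
  linarith [hcon.1, hcon.2]

lemma tendstoInMeasure_inv_mul {Ω : Type*} [MeasurableSpace Ω] {P : Measure Ω}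
    {X Y : ℕ → Ω → ℝ} {x y : ℝ} (hx : x ≠ 0) (hX : TendstoInMeasure P X atTop (fun _ => x))
    (hY : TendstoInMeasure P Y atTop (fun _ => y)) :
    TendstoInMeasure P (fun n ω => (X n ω)⁻¹ * Y n ω) atTop (fun _ => x⁻¹ * y) := by
  rw [tendstoInMeasure_iff_norm] at *
  intro ε hε
  have hc : ContinuousAt (fun p : ℝ × ℝ => p.1⁻¹ * p.2) (x, y) :=
    (continuousAt_fst.inv₀ hx).mul continuousAt_snd
  obtain ⟨δ, hδ0, hδ⟩ := Metric.continuousAt_iff.1 hc ε hε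
  have h1 := (hX δ hδ0).add (hY δ hδ0)
  rw [add_zero] at h1
  refine tendsto_of_tendsto_of_tendsto_of_le_of_le tendsto_const_nhds h1
    (fun _ => zero_le) fun n => ?_
  refine (measure_mono fun ω hω => ?_).trans (measure_union_le _ _)
  by_contra hcon
  simp only [Set.mem_union, Set.mem_ofPred_eq, not_or, not_le] at hcon hω
  have := hδ (x := (X n ω, Y n ω)) (by
    rw [Prod.dist_eq, dist_eq_norm, dist_eq_norm]; exact max_lt hcon.1 hcon.2)
  rw [dist_eq_norm] at this
  exact absurd hω (not_le.2 this)

/-- The normalized weighted sums have the limit of the kernel means at the true index. -/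
lemma tendstoInMeasure_weighted_average {Ω : Type*} [MeasurableSpace Ω] {P : Measure Ω}
    [IsProbabilityMeasure P] {k J₁ J₂ dU dV : ℕ} {Z : ℕ → Ω → Vec k}
    (hZ : ∀ i, Measurable (Z i)) (hind : iIndepFun Z P)
    (hμ : ∀ i, P.map (Z i) = P.map (Z 0))
    {Pi0 : Vec k → Vec J₁} (hPi0 : Measurable Pi0) {δ0 : Matrix (Fin k) (Fin J₂) ℝ}
    (e : Fin J₁ ⊕ Fin J₂ ≃ Fin dU ⊕ Fin dV)
    {K : Vec dU × Vec dV → ℝ} (hK : IsKernel K) {h : ℕ → ℝ} (hh : IsBandwidth dU h)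
    {PiHat : ℕ → Ω → Vec k → Vec J₁} {δHat : ℕ → Ω → Matrix (Fin k) (Fin J₂) ℝ}
    (h_prelim : IsLittleOP P
      (fun n ω => max (⨆ z ∈ (P.map (Z 0)).support, ‖PiHat n ω z - Pi0 z‖ₑ)
        ‖δHat n ω - δ0‖ₑ) h)
    {C : ℝ≥0} (hC : HasBoundedIncrements (P.map (Z 0)) (partU e Pi0 δ0) C)
    (h4 : ∫⁻ x, ‖x‖ₑ ^ 4 ∂(P.map (Z 0)) ≠ ∞)
    (hM : ∫⁻ x, (1 + 2 * ‖x‖ₑ) ^ (2 + linearCount e) ∂(P.map (Z 0)) ≠ ∞)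
    {φ : Vec k → Vec k → ℝ} (hφm : Measurable fun p : Vec k × Vec k => φ p.1 p.2)
    (hφ : ∀ x y, |φ x y| ≤ 1 + ‖x - y‖ ^ 2) {ℓ : ℝ}
    (hℓ : Tendsto (fun n => (h n ^ dU)⁻¹ * ∫ p, pairWeight e K (h n) Pi0 δ0 p.1 p.2 * φ p.1 p.2
      ∂((P.map (Z 0)).prod (P.map (Z 0)))) atTop (𝓝 ℓ)) :
    TendstoInMeasure P (fun n ω => ((Finset.range n).offDiag.card : ℝ)⁻¹ * (h n ^ dU)⁻¹ *
      ∑ p ∈ (Finset.range n).offDiag,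
        pairWeight e K (h n) (PiHat n ω) (δHat n ω) (Z p.1 ω) (Z p.2 ω) * φ (Z p.1 ω) (Z p.2 ω))
      atTop (fun _ => ℓ) := by
  have hprob : IsProbabilityMeasure (P.map (Z 0)) :=
    Measure.isProbabilityMeasure_map (hZ 0).aemeasurable
  have hU := measurable_partU e hPi0 δ0
  have herr := tendstoInMeasure_estimation_error hZ hind hμ e hU hK hh.pos h_prelim hC hM hφ
  obtain ⟨B, hB0, hB⟩ := hK.exists_pairWeight_le e Pi0 δ0
  lift B to ℝ≥0 using hB0
  obtain ⟨A, hA0, hA⟩ := exists_lintegral_pairEnvelope_sq_le e hU hC h4 B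
  set Φ : ℝ → ℝ≥0∞ := fun r => (B : ℝ≥0∞) * (1 + ENNReal.ofReal r ^ 2) with hΦ
  have hΦm : Measurable Φ := by fun_prop
  have htriple : ∀ n, ∫⁻ p, pairEnvelope e (partU e Pi0 δ0) (h n) (fun _ => 1) Φ (p.1.1, p.1.2) *
      pairEnvelope e (partU e Pi0 δ0) (h n) (fun _ => 1) Φ (p.1.1, p.2)
        ∂(((P.map (Z 0)).prod (P.map (Z 0))).prod (P.map (Z 0))) ≤
      ENNReal.ofReal (2 * C * 6 ^ dU * A * (h n ^ dU) ^ 2) := by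
    intro n
    have hn := (hh.pos n).le
    refine (lintegral_pairEnvelope_mul_le e hU hC hn hΦm).trans
      ((mul_le_mul_right (hA (h n) hn) _).trans (le_of_eq ?_))
    rw [← ENNReal.ofReal_coe_nnreal (p := C), show (2 : ℝ≥0∞) = ENNReal.ofReal 2 by simp,
      ← ENNReal.ofReal_mul C.coe_nonneg, ← ENNReal.ofReal_mul (by positivity),
      ← ENNReal.ofReal_mul (by positivity)]
    congr 1
    rw [mul_pow]
    ring
  have horacle := tendstoInMeasure_average_offDiag hZ hind hμ hh
    (g := fun n p => pairWeight e K (h n) Pi0 δ0 p.1 p.2 * φ p.1 p.2)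
    (Q := fun n => pairEnvelope e (partU e Pi0 δ0) (h n) (fun _ => 1) Φ)
    (fun n => (measurable_pairWeight e hK (h n) hPi0 δ0).mul hφm)
    (fun n => measurable_pairEnvelope e hU (h n) measurable_const hΦm)
    (fun n x y => pairEnvelope_swap e _ _ _ _ x y)
    (fun n p => ?_) hA0 (by positivity) (fun n => hA (h n) (hh.pos n).le) htriple hℓ
  · refine (tendstoInMeasure_add_zero herr horacle).congr_left fun n => ?_
    refine Eventually.of_forall fun ω => ?_
    simp only
    rw [← mul_add, ← Finset.sum_add_distrib]
    congr 1
    exact Finset.sum_congr rfl fun p _ => by ring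
  · have h1 := hB (h n) (hh.pos n) p.1 p.2
    rw [enorm_mul, ← ofReal_norm, ← ofReal_norm, Real.norm_eq_abs, Real.norm_eq_abs]
    simp only [pairEnvelope]
    split_ifs with hmem
    · rw [Set.indicator_of_mem hmem] at h1
      simp only [hΦ]
      refine mul_le_mul' ?_ ?_
      · rw [← ENNReal.ofReal_coe_nnreal]
        exact ENNReal.ofReal_le_ofReal h1
      · refine (ENNReal.ofReal_le_ofReal (hφ p.1 p.2)).trans (le_of_eq ?_)
        rw [ENNReal.ofReal_add zero_le_one (by positivity), ENNReal.ofReal_one,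
          ENNReal.ofReal_pow (norm_nonneg _)]
    · rw [Set.indicator_of_notMem hmem] at h1
      rw [ENNReal.ofReal_eq_zero.2 h1]
      simp

/-- For small bandwidths the kernel only sees pairs with `V₁ = V₂`, because `V` has finitely many
values. -/
lemma eventually_integral_pairWeight_eq {Ω : Type*} [MeasurableSpace Ω] {P : Measure Ω}
    [IsProbabilityMeasure P] {k J₁ J₂ dU dV : ℕ} {Z : ℕ → Ω → Vec k}
    (hZ : ∀ i, Measurable (Z i)) (hind : iIndepFun Z P)
    (hμ : ∀ i, P.map (Z i) = P.map (Z 0))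
    {Pi0 : Vec k → Vec J₁} (hPi0 : Measurable Pi0) {δ0 : Matrix (Fin k) (Fin J₂) ℝ}
    (e : Fin J₁ ⊕ Fin J₂ ≃ Fin dU ⊕ Fin dV)
    (S : Finset (Vec dV)) (hS : ∀ᵐ x ∂(P.map (Z 0)), partV e Pi0 δ0 x ∈ S)
    {K : Vec dU × Vec dV → ℝ} (hK : IsKernel K) {h : ℕ → ℝ} (hh : IsBandwidth dU h)
    (hE : P {ω | partV e Pi0 δ0 (Z 0 ω) = partV e Pi0 δ0 (Z 1 ω)} ≠ 0)
    {φ : Vec k → Vec k → ℝ} (hφm : Measurable fun p : Vec k × Vec k => φ p.1 p.2) :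
    ∀ᶠ n in atTop, ∫ p, pairWeight e K (h n) Pi0 δ0 p.1 p.2 * φ p.1 p.2
        ∂((P.map (Z 0)).prod (P.map (Z 0))) =
      (P {ω | partV e Pi0 δ0 (Z 0 ω) = partV e Pi0 δ0 (Z 1 ω)}).toReal *
        ∫ ω, K ((h n)⁻¹ • (partU e Pi0 δ0 (Z 0 ω) - partU e Pi0 δ0 (Z 1 ω)), 0) *
          φ (Z 0 ω) (Z 1 ω)
          ∂(ProbabilityTheory.cond P {ω | partV e Pi0 δ0 (Z 0 ω) = partV e Pi0 δ0 (Z 1 ω)}) := by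
  have hV := measurable_partV e hPi0 δ0
  set V := partV e Pi0 δ0 with hVdef
  set A : Set Ω := {ω | V (Z 0 ω) = V (Z 1 ω)} with hA
  have hAm : MeasurableSet A :=
    measurableSet_eq_fun (hV.comp (hZ 0)) (hV.comp (hZ 1))
  have hsep : ∀ᶠ n in atTop, ∀ v ∈ S, ∀ v' ∈ S, v ≠ v' → h n ≤ ‖v - v'‖ := by
    rw [eventually_all_finset]
    intro v _
    rw [eventually_all_finset]
    intro v' _
    by_cases hvv : v = v'
    · simp [hvv]
    · filter_upwards [hh.tendsto_zero.eventually_lt_const (norm_pos_iff.2 (sub_ne_zero.2 hvv))]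
        with n hn _
      exact hn.le
  have hS' : ∀ i, ∀ᵐ ω ∂P, V (Z i ω) ∈ S := fun i =>
    ae_of_ae_map (hZ i).aemeasurable (by rw [hμ i]; exact hS)
  filter_upwards [hsep] with n hn
  have hn0 := hh.pos n
  rw [← map_pair_eq_prod hZ hind hμ zero_ne_one, integral_map
    (f := fun p : Vec k × Vec k => pairWeight e K (h n) Pi0 δ0 p.1 p.2 * φ p.1 p.2)
    ((hZ 0).prodMk (hZ 1)).aemeasurable
    ((measurable_pairWeight e hK (h n) hPi0 δ0).mul hφm).aestronglyMeasurable]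
  rw [ProbabilityTheory.cond, integral_smul_measure, smul_eq_mul, ← mul_assoc,
    ENNReal.toReal_inv, mul_inv_cancel₀ (ENNReal.toReal_ne_zero.2 ⟨hE, measure_ne_top _ _⟩),
    one_mul, ← integral_indicator hAm]
  refine integral_congr_ae ?_
  filter_upwards [hS' 0, hS' 1] with ω h0 h1
  by_cases hω : ω ∈ A
  · rw [Set.indicator_of_mem hω]
    have hVV : V (Z 0 ω) - V (Z 1 ω) = 0 := sub_eq_zero.2 hω
    simp only [pairWeight]
    rw [← hVdef, hVV, smul_zero]
  · rw [Set.indicator_of_notMem hω]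
    have : pairWeight e K (h n) Pi0 δ0 (Z 0 ω) (Z 1 ω) = 0 := by
      refine hK.support _ _ (Or.inr ?_)
      rw [norm_smul, norm_inv, Real.norm_of_nonneg hn0.le, ← div_eq_inv_mul, one_le_div hn0]
      exact hn _ h0 _ h1 hω
    simp [this]

/-- The event `V₁ = V₂` has positive probability, and given this event the density of `U₁ - U₂` is
positive at zero: a value `v` of `V` with positive probability provides two independent copies
of `U`, restricted to `V = v`. -/
lemma cond_density_zero_pos {Ω : Type*} [MeasurableSpace Ω] {P : Measure Ω}
    [IsProbabilityMeasure P] {k dU dV : ℕ} {Z : ℕ → Ω → Vec k}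
    (hZ : ∀ i, Measurable (Z i)) (hind : iIndepFun Z P)
    (hμ : ∀ i, P.map (Z i) = P.map (Z 0)) {U : Vec k → Vec dU} (hU : Measurable U)
    {V : Vec k → Vec dV} (hV : Measurable V) (S : Finset (Vec dV))
    (hS : ∀ᵐ x ∂(P.map (Z 0)), V x ∈ S) :
    P {ω | V (Z 0 ω) = V (Z 1 ω)} ≠ 0 ∧ ∀ f : Vec dU → ℝ,
      IsDensity (ProbabilityTheory.cond P {ω | V (Z 0 ω) = V (Z 1 ω)})
        (fun ω => U (Z 0 ω) - U (Z 1 ω)) f → ContinuousAt f 0 → 0 < f 0 := by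
  have hprob : IsProbabilityMeasure (P.map (Z 0)) :=
    Measure.isProbabilityMeasure_map (hZ 0).aemeasurable
  set μ := P.map (Z 0) with hμdef
  obtain ⟨v, hv⟩ : ∃ v, μ {x | V x = v} ≠ 0 := by
    by_contra! hc
    have h0 : μ (⋃ v ∈ S, {x | V x = v}) = 0 :=
      (measure_biUnion_null_iff S.countable_toSet).2 fun v _ => hc v
    have h1 : ∀ᵐ x ∂μ, x ∈ ⋃ v ∈ S, {x | V x = v} := by
      filter_upwards [hS] with x hx
      simpa using hx
    have h2 : (⋃ v ∈ S, {x | V x = v}) =ᵐ[μ] Set.univ := eventuallyEq_univ.2 h1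
    rw [measure_congr h2, measure_univ] at h0
    exact one_ne_zero h0
  set A : Set (Vec k) := {x | V x = v} with hA
  have hAm : MeasurableSet A := hV (measurableSet_singleton v)
  set T : Set Ω := {ω | V (Z 0 ω) = V (Z 1 ω)} with hT
  have hTm : MeasurableSet T := measurableSet_eq_fun (hV.comp (hZ 0)) (hV.comp (hZ 1))
  have hlaw := map_pair_eq_prod hZ hind hμ (zero_ne_one : (0 : ℕ) ≠ 1)
  have hpair : Measurable fun ω => (Z 0 ω, Z 1 ω) := (hZ 0).prodMk (hZ 1)
  have hT0 : P T ≠ 0 := by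
    refine ne_of_gt (lt_of_lt_of_le (pos_iff_ne_zero.2 (mul_ne_zero hv hv)) ?_)
    rw [← Measure.prod_prod, ← hlaw, Measure.map_apply hpair (hAm.prod hAm)]
    refine measure_mono fun ω hω => ?_
    exact hω.1.trans hω.2.symm
  refine ⟨hT0, fun f hf hfc => ?_⟩
  set ρ : Measure (Vec dU) := (μ.restrict A).map U with hρ
  have hρ0 : ρ ≠ 0 := by
    rw [hρ, ne_eq, Measure.map_eq_zero_iff hU.aemeasurable, Measure.restrict_eq_zero]
    exact hv
  refine density_zero_pos ρ hρ0 hf.2.1 hfc (a := (P T)⁻¹)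
    (ENNReal.inv_ne_zero.2 (measure_ne_top _ _)) fun ε _ => ?_
  have hBm : MeasurableSet (Metric.ball (0 : Vec dU) ε) := Metric.isOpen_ball.measurableSet
  rw [← withDensity_apply _ hBm, ← hf.2.2, Measure.map_apply (by fun_prop) hBm,
    ProbabilityTheory.cond_apply hTm]
  gcongr
  have hDm : MeasurableSet {p : Vec dU × Vec dU | p.1 - p.2 ∈ Metric.ball (0 : Vec dU) ε} :=
    (measurable_fst.sub measurable_snd) hBm
  rw [hρ, Measure.map_prod_map _ _ hU hU, Measure.map_apply (by fun_prop) hDm,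
    Measure.prod_restrict, Measure.restrict_apply ((by fun_prop : Measurable (Prod.map U U)) hDm),
    ← hlaw, Measure.map_apply hpair
      (((by fun_prop : Measurable (Prod.map U U)) hDm).inter (hAm.prod hAm))]
  refine measure_mono fun ω hω => ⟨?_, hω.1⟩
  exact hω.2.1.trans hω.2.2.symm

end PairwiseDifference

end

/-! ### Consistency of the estimator -/

theorem mainTheorem6
    {Ω : Type*} [MeasurableSpace Ω] (P : Measure Ω) [IsProbabilityMeasure P]
    {k J₁ J₂ dU dV : ℕ}
    -- the i.i.d. data
    (Z : ℕ → Ω → PairwiseDifference.Vec k)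
    (hZ_meas : ∀ i, Measurable (Z i))
    (hZ_indep : iIndepFun Z P)
    (hZ_ident : ∀ i, IdentDistrib (Z i) (Z 0) P P)
    -- the true index functions, arranged into a continuous part `U` and a discrete part `V`
    (Pi0 : PairwiseDifference.Vec k → PairwiseDifference.Vec J₁) (hPi0 : Measurable Pi0)
    (δ0 : Matrix (Fin k) (Fin J₂) ℝ)
    (e : Fin J₁ ⊕ Fin J₂ ≃ Fin dU ⊕ Fin dV)
    (U : PairwiseDifference.Vec k → PairwiseDifference.Vec dU)
    (hU : U = PairwiseDifference.partU e Pi0 δ0)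
    (V : PairwiseDifference.Vec k → PairwiseDifference.Vec dV)
    (hV : V = PairwiseDifference.partV e Pi0 δ0)
    (hV_finite : ∃ S : Finset (PairwiseDifference.Vec dV), ∀ᵐ ω ∂P, V (Z 0 ω) ∈ S)
    -- kernel and bandwidth
    (K : PairwiseDifference.Vec dU × PairwiseDifference.Vec dV → ℝ)
    (hK : PairwiseDifference.IsKernel K)
    (h : ℕ → ℝ) (hh : PairwiseDifference.IsBandwidth dU h)
    -- preliminary estimators
    (PiHat : ℕ → Ω → PairwiseDifference.Vec k → PairwiseDifference.Vec J₁)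
    (δHat : ℕ → Ω → Matrix (Fin k) (Fin J₂) ℝ)
    (h_prelim : PairwiseDifference.IsLittleOP P
      (fun n ω => max (⨆ z ∈ (P.map (Z 0)).support, ‖PiHat n ω z - Pi0 z‖ₑ)
        ‖δHat n ω - δ0‖ₑ) h)
    -- the difference `U₁ - U₂` and the conditional probability given `V₁ = V₂`
    (U₁₂ : Ω → PairwiseDifference.Vec dU) (hU₁₂ : U₁₂ = fun ω => U (Z 0 ω) - U (Z 1 ω))
    (PV : Measure Ω) (hPV : PV = ProbabilityTheory.cond P {ω | V (Z 0 ω) = V (Z 1 ω)})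
    -- smoothness near zero
    (f : PairwiseDifference.Vec dU → ℝ) (hf : PairwiseDifference.IsDensity PV U₁₂ f)
    (hf_smooth : ContDiffAt ℝ 2 f 0)
    (m : PairwiseDifference.Vec dU → Matrix (Fin k) (Fin k) ℝ)
    (hm : PairwiseDifference.IsPairRegression PV (Z 0) (Z 1) U₁₂ m)
    (hmf_smooth : ∀ a b, ContDiffAt ℝ 2 (fun u => m u a b * f u) 0)
    -- boundedness
    (h_bdd_density : ∃ C : ℝ≥0, PairwiseDifference.HasDensityLE (P.map U₁₂) C)
    (h_bdd_condDensity : ∃ C : ℝ≥0, ∀ᵐ z ∂(P.map (Z 0)),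
      PairwiseDifference.HasDensityLE (condDistrib U₁₂ (Z 0) P z) C)
    (h_bdd_first : PairwiseDifference.HasBoundedCondMean P
      (fun ω => ‖Z 1 ω‖) (fun ω => (U₁₂ ω, Z 0 ω)))
    (h_bdd_second : PairwiseDifference.HasBoundedCondMean P
      (fun ω => ‖Z 1 ω‖ ^ 2) (fun ω => (U₁₂ ω, Z 0 ω)))
    (h_bdd_fourth : PairwiseDifference.HasBoundedCondMean PV
      (fun ω => ‖Z 0 ω - Z 1 ω‖ ^ 4) U₁₂)
    -- moment condition, needed only if `U` has three or more coordinates from `δ0ᵀ Z`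
    (h_moment : 3 ≤ PairwiseDifference.linearCount e →
      Integrable (fun ω => ‖Z 0 ω‖ ^ (2 + PairwiseDifference.linearCount e)) P)
    -- the constraint matrix `Σ₀`
    (Sigma0 : Matrix (Fin k) (Fin k) ℝ) (hSigma0 : Sigma0 = m 0) :
    PairwiseDifference.IsLittleOP P
      (fun n ω => ‖PairwiseDifference.sigmaTilde e K (h n) (PiHat n ω) (δHat n ω) n
        (fun i => Z i ω) - Sigma0‖ₑ)
      (fun _ => 1) := by
  have hμ : ∀ i, P.map (Z i) = P.map (Z 0) := fun i => (hZ_ident i).map_eq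
  have hprob : IsProbabilityMeasure (P.map (Z 0)) :=
    Measure.isProbabilityMeasure_map (hZ_meas 0).aemeasurable
  have hUm : Measurable U := hU ▸ PairwiseDifference.measurable_partU e hPi0 δ0
  have hVm : Measurable V := hV ▸ PairwiseDifference.measurable_partV e hPi0 δ0
  obtain ⟨S, hS⟩ := hV_finite
  have hSμ : ∀ᵐ x ∂(P.map (Z 0)), V x ∈ S :=
    (ae_map_iff (hZ_meas 0).aemeasurable (hVm S.measurableSet)).2 hS
  have hU₁₂m : Measurable U₁₂ := by
    rw [hU₁₂]
    exact (hUm.comp (hZ_meas 0)).sub (hUm.comp (hZ_meas 1))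
  set T : Set Ω := {ω | V (Z 0 ω) = V (Z 1 ω)} with hT
  have hTm : MeasurableSet T :=
    measurableSet_eq_fun (hVm.comp (hZ_meas 0)) (hVm.comp (hZ_meas 1))
  obtain ⟨hT0, hpos⟩ :=
    PairwiseDifference.cond_density_zero_pos hZ_meas hZ_indep hμ hUm hVm S hSμ
  have hf0 : 0 < f 0 := hpos f (by rw [hPV, hU₁₂] at hf; exact hf) hf_smooth.continuousAt
  have hPVprob : IsProbabilityMeasure PV := hPV ▸ ProbabilityTheory.cond_isProbabilityMeasure hT0
  have h4 : ∫⁻ x, ‖x‖ₑ ^ 4 ∂(P.map (Z 0)) ≠ ∞ := by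
    refine PairwiseDifference.lintegral_norm_pow_four_ne_top _ hVm S hSμ ?_
    have hset : MeasurableSet {p : PairwiseDifference.Vec k × PairwiseDifference.Vec k |
        V p.1 = V p.2} := measurableSet_eq_fun (by fun_prop) (by fun_prop)
    have hint := h_bdd_fourth.1
    rw [hPV, ProbabilityTheory.cond, integrable_smul_measure
      (ENNReal.inv_ne_zero.2 (measure_ne_top _ _)) (ENNReal.inv_ne_top.2 hT0)] at hint
    rw [← PairwiseDifference.map_pair_eq_prod hZ_meas hZ_indep hμ zero_ne_one,
      setLIntegral_map hset (by fun_prop) ((hZ_meas 0).prodMk (hZ_meas 1))]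
    refine ne_of_lt (lt_of_le_of_lt (le_of_eq ?_) hint.2)
    refine lintegral_congr fun ω => ?_
    rw [enorm_pow, enorm_norm]
  have hM : ∫⁻ x, (1 + 2 * ‖x‖ₑ) ^ (2 + PairwiseDifference.linearCount e) ∂(P.map (Z 0)) ≠ ∞ := by
    refine PairwiseDifference.lintegral_one_add_pow_two_add_ne_top h4 fun hq => ?_
    rw [lintegral_map (by fun_prop) (hZ_meas 0)]
    refine ne_of_lt (lt_of_le_of_lt (le_of_eq ?_) (h_moment hq).2)
    refine lintegral_congr fun ω => ?_
    rw [enorm_pow, enorm_norm]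
  obtain ⟨C, hC⟩ := h_bdd_condDensity
  have hCμ : PairwiseDifference.HasBoundedIncrements (P.map (Z 0)) U C :=
    PairwiseDifference.hasBoundedIncrements_of_condDistrib (hZ_meas 0) (hZ_meas 1)
      (hZ_indep.indepFun zero_ne_one) (hμ 1) hUm (by rw [hU₁₂] at hC; exact hC)
  -- the limit of the weighted averages of a function `φ` with regression function `ψ`
  have key : ∀ (φ : PairwiseDifference.Vec k → PairwiseDifference.Vec k → ℝ)
      (ψ : PairwiseDifference.Vec dU → ℝ),
      (Measurable fun p : PairwiseDifference.Vec k × PairwiseDifference.Vec k => φ p.1 p.2) →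
      (∀ x y, |φ x y| ≤ 1 + ‖x - y‖ ^ 2) → Integrable (fun ω => φ (Z 0 ω) (Z 1 ω)) PV →
      PV[fun ω => φ (Z 0 ω) (Z 1 ω) | MeasurableSpace.comap U₁₂ inferInstance]
        =ᵐ[PV] (fun ω => ψ (U₁₂ ω)) → ContDiffAt ℝ 2 (fun u => ψ u * f u) 0 →
      TendstoInMeasure P (fun n ω => ((Finset.range n).offDiag.card : ℝ)⁻¹ * (h n ^ dU)⁻¹ *
        ∑ p ∈ (Finset.range n).offDiag, PairwiseDifference.pairWeight e K (h n) (PiHat n ω)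
          (δHat n ω) (Z p.1 ω) (Z p.2 ω) * φ (Z p.1 ω) (Z p.2 ω))
        atTop (fun _ => (P T).toReal * (ψ 0 * f 0)) := by
    intro φ ψ hφm hφ hφint hφψ hψ
    have hlim := PairwiseDifference.tendsto_integral_kernel hK hh.pos hh.tendsto_zero hU₁₂m hf
      ((hf_smooth.eventually (by simp)).mono fun u hu => hu.continuousAt) hf0 hφint hφψ
      ((hψ.eventually (by simp)).mono fun u hu => hu.continuousAt)
    subst hU hV
    refine PairwiseDifference.tendstoInMeasure_weighted_average hZ_meas hZ_indep hμ hPi0 e hK hh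
      h_prelim hCμ h4 hM hφm hφ ?_
    refine (hlim.const_mul (P T).toReal).congr' ?_
    filter_upwards [PairwiseDifference.eventually_integral_pairWeight_eq hZ_meas hZ_indep hμ hPi0 e
      S hSμ hK hh hT0 hφm] with n hn
    rw [hn, hPV, hU₁₂]
    ring
  have hden := key (fun _ _ => 1) (fun _ => 1) measurable_const
    (fun x y => by rw [abs_one]; linarith [sq_nonneg ‖x - y‖]) (integrable_const _)
    (by rw [condExp_const hU₁₂m.comap_le]) (by simpa using hf_smooth)
  have hnum : ∀ a b, _ := fun a b =>
    key (fun x y => PairwiseDifference.outerDiff x y a b) (fun u => m u a b)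
      (by
        simp only [PairwiseDifference.outerDiff, Matrix.vecMulVec_apply]
        have hp : ∀ c, Measurable fun z : PairwiseDifference.Vec k => z c := fun c =>
          (EuclideanSpace.proj (𝕜 := ℝ) c).continuous.measurable
        exact (((hp a).comp measurable_fst).sub ((hp a).comp measurable_snd)).mul
          (((hp b).comp measurable_fst).sub ((hp b).comp measurable_snd)))
      (fun x y => PairwiseDifference.abs_outerDiff_le x y a b) (hm a b).1 (hm a b).2
      (hmf_smooth a b)
  have hpv : 0 < (P T).toReal := ENNReal.toReal_pos hT0 (measure_ne_top _ _)
  -- the normalization cancels in each entry of the estimator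
  have hentry : ∀ a b, TendstoInMeasure P (fun n ω => PairwiseDifference.sigmaTilde e K (h n)
      (PiHat n ω) (δHat n ω) n (fun i => Z i ω) a b) atTop (fun _ => Sigma0 a b) := by
    intro a b
    have hratio := PairwiseDifference.tendstoInMeasure_inv_mul (by positivity) hden (hnum a b)
    have hval : ((P T).toReal * (1 * f 0))⁻¹ * ((P T).toReal * (m 0 a b * f 0)) = Sigma0 a b := by
      rw [hSigma0]; field_simp
    rw [hval] at hratio
    refine hratio.congr' ?_ (Eventually.of_forall fun _ => rfl)
    filter_upwards [eventually_ge_atTop 2] with n hn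
    refine Eventually.of_forall fun ω => ?_
    have hN : (0 : ℝ) < ((Finset.range n).offDiag.card : ℝ) := by
      rw [Nat.cast_pos, Finset.offDiag_card, Finset.card_range]
      have : n * 2 ≤ n * n := Nat.mul_le_mul_left n hn
      omega
    have hh0 := hh.pos n
    simp only [PairwiseDifference.sigmaTilde, Matrix.smul_apply, Matrix.sum_apply, smul_eq_mul,
      mul_one]
    rw [mul_inv, mul_inv, inv_inv, inv_inv]
    field_simp
  -- the Frobenius norm is at most the sum of the entries, and `+ 1` avoids the division by zero
  -- for `k = 0`
  intro ε hε
  have hcard : 0 < (Fintype.card (Fin k × Fin k) : ℝ) + 1 := by positivity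
  have hsum : Tendsto (fun n => ∑ p : Fin k × Fin k,
      P {ω | ε / ((Fintype.card (Fin k × Fin k) : ℝ) + 1) ≤
        ‖PairwiseDifference.sigmaTilde e K (h n) (PiHat n ω) (δHat n ω) n (fun i => Z i ω) p.1 p.2
          - Sigma0 p.1 p.2‖}) atTop (𝓝 0) := by
    rw [← Finset.sum_const_zero (s := (Finset.univ : Finset (Fin k × Fin k)))]
    refine tendsto_finsetSum _ fun p _ => ?_
    exact tendstoInMeasure_iff_norm.1 (hentry p.1 p.2) _ (by positivity)
  refine tendsto_of_tendsto_of_tendsto_of_le_of_le tendsto_const_nhds hsum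
    (fun _ => zero_le) fun n => ?_
  refine (measure_mono fun ω hω => ?_).trans (measure_iUnion_fintype_le _ _)
  by_contra hcon
  simp only [Set.mem_iUnion, Set.mem_ofPred_eq, not_exists, not_le, mul_one] at hcon hω
  rw [← ofReal_norm] at hω
  have h1 := (ENNReal.ofReal_lt_ofReal_iff_of_nonneg hε.le).1 hω
  have h2 := PairwiseDifference.norm_matrix_le_sum_abs
    (PairwiseDifference.sigmaTilde e K (h n) (PiHat n ω) (δHat n ω) n (fun i => Z i ω) - Sigma0)
  have h3 := Finset.sum_le_sum (s := Finset.univ) fun p _ => (hcon p).le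
  rw [Finset.sum_const, Finset.card_univ, nsmul_eq_mul] at h3
  have h4 : (Fintype.card (Fin k × Fin k) : ℝ) * (ε / ((Fintype.card (Fin k × Fin k) : ℝ) + 1))
      ≤ ε := by
    rw [← mul_div_assoc, div_le_iff₀ hcard]
    nlinarith
  simp only [Matrix.sub_apply] at h2
  simp only [Real.norm_eq_abs] at h3
  linarith
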